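/- For a congruence subgroup $\Gamma\subset \mathrm{SL}_2(\mathbf Z)$ and an integer $k$, let $S_k(\Gamma)$ be the finite-dimensional space of holomorphic cusp forms of weight $k$ on $\Gamma$, with the Petersson inner product $$\langle F,G\rangle=\int_{\Gamma\backslash\mathbf H}F(z)\overline{G(z)}\,y^{k}\,\frac{dx\,dy}{y^{2}}$$ (not normalized by the volume of $\Gamma\backslash \mathbf H$), where $z=x+iy$ and $\mathbf H$ is the upper half-plane. Put $$\sup(S_k(\Gamma)):=\sup_{z\in\mathbf H}\ \sum_{F\in B}y^{k}|F(z)|^{2},$$ where $B$ is any orthonormal basis of $S_k(\Gamma)$. **Theorem.** There are absolute constants $c,C>0$ such that for every congruence subgroup $\Gamma\subset\mathrm{SL}_2(\mathbf Z)$ and every integer $k>2$ one has $\sup(S_k(\Gamma))\le C\,k^{3/2}$, and moreover $c\,k^{3/2}\le \sup(S_k(\Gamma))$ whenever $S_k(\Gamma)\neq\{0\}$. That is, $\sup(S_k(\Gamma))\asymp k^{3/2}$ with absolute implied constants (in particular, $\sup(S_k(\Gamma))\asymp_k 1$ as $\Gamma$ varies with $k$ fixed), as long as $S_k(\Gamma)\ne\{0\}$.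 -/

import Mathlib

open scoped MatrixGroups ModularForm Pointwise ENNReal

noncomputable section

namespace CuspSize

/-- The space `S_k(Γ)` of holomorphic cusp forms of weight `k` on a subgroup `Γ` of `SL(2, ℤ)`. -/
abbrev S (Γ : Subgroup SL(2, ℤ)) (k : ℤ) : Type :=
  CuspForm (Γ.map (Matrix.SpecialLinearGroup.mapGL ℝ)) k

/-- The fundamental domain `⋃ⱼ γⱼ 𝒟` for the action of `Γ` on the upper half-plane, where `𝒟` is
the standard fundamental domain of `SL(2, ℤ)` and `SL(2, ℤ)` is the disjoint union of the cosets
`{±1} Γ γⱼ`. (Both signs are put in because `-1` acts trivially.) The `γⱼ` are the inverses of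
representatives of the left cosets of `{±1} Γ`. -/
def fundDomain (Γ : Subgroup SL(2, ℤ)) : Set UpperHalfPlane :=
  ⋃ q : SL(2, ℤ) ⧸ (Γ ⊔ Subgroup.zpowers (-1 : SL(2, ℤ))), (Quotient.out q)⁻¹ • ModularGroup.fd

/-- The Petersson inner product `⟨F, G⟩ = ∫_{Γ \ ℍ} F(z) conj(G(z)) y ^ k dx dy / y ^ 2`,
not normalized by the volume. The measure `dx dy / y ^ 2` is the `volume` on the upper half-plane.
-/
def peterssonInner (Γ : Subgroup SL(2, ℤ)) (k : ℤ) (F G : S Γ k) : ℂ :=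
  ∫ z in fundDomain Γ, UpperHalfPlane.petersson k G F z

/-- A finite basis of `S_k(Γ)` is orthonormal for the Petersson inner product. -/
def IsPeterssonOrthonormal {Γ : Subgroup SL(2, ℤ)} {k : ℤ} {n : ℕ}
    (B : Module.Basis (Fin n) ℂ (S Γ k)) : Prop :=
  ∀ i j, peterssonInner Γ k (B i) (B j) = if i = j then 1 else 0

/-- The invariant Bergman kernel on the diagonal, `𝔹(z) = ∑_{F ∈ B} y ^ k |F(z)| ^ 2`. -/
def bergman {Γ : Subgroup SL(2, ℤ)} {k : ℤ} {n : ℕ}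
    (B : Module.Basis (Fin n) ℂ (S Γ k)) (z : UpperHalfPlane) : ℝ :=
  ∑ i, z.im ^ k * ‖B i z‖ ^ 2

/-- The size `sup(S_k(Γ)) = sup_z 𝔹(z)`, computed in an orthonormal basis `B`, as an element of
`[0, ∞]`. -/
def size {Γ : Subgroup SL(2, ℤ)} {k : ℤ} {n : ℕ}
    (B : Module.Basis (Fin n) ℂ (S Γ k)) : ℝ≥0∞ :=
  ⨆ z : UpperHalfPlane, ENNReal.ofReal (bergman B z)

end CuspSize

end

/-!
The upper bound. The mean value inequality on a hyperbolic disc of radius about `k ^ (-1/2)`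
bounds `y ^ k |F(z)| ^ 2` by a multiple of `k` times the integral over the disc
(`pnorm_le_lintegral_disc`). Let `z` be in the standard fundamental domain. If `z` is low, the
disc meets a bounded number of translates of that domain (`exists_pnorm_le_of_im_le_two`). If it
is high, the translates it meets are horizontal, about `y k ^ (-1/2)` in number; as the cusp has
width `h`, each orbit of `Γ` is met about `1 + y k ^ (-1/2) / h` times, which gives `k ^ (3/2)` up
to the height `k h` (`pnorm_le_of_two_le_im`). Above that height the form decays by the maximum
principle applied to its expansion in `q` (`norm_le_mul_exp_of_periodic`). Other `z` are reached
by conjugating `Γ` inside `SL(2, ℤ)`. The bound for single forms gives the bound for orthonormal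
families (`exists_sum_pnorm_le`), whose integral over the fundamental domain, of finite volume,
shows that `S_k(Γ)` is finite-dimensional.

The lower bound. By the Cauchy–Schwarz inequality (`pnorm_le_energy_mul_bergman`) it suffices to
exhibit a form `F` and a point `z` with `y ^ k |F(z)| ^ 2 ≥ c k ^ (3/2) ‖F‖ ^ 2`. At a cusp of
width `w` consider the Poincaré series `Q` of the exponential `exp (2 π i z / h)`, where `h` is
`w`, or `2 w` if the weight is odd and the cusp irregular. If `k h` is large, `Q` is at least
about its first term at the height `k h / (4 π)` where that term is extremal (`norm_poincare_ge`).
Let `M` be the supremum of `y ^ (k / 2) |Q|`. Then `‖Q‖ ^ 2` is at most `M` times the integral of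
`y ^ (k / 2) |Q|`, which unfolds to sums over the bottom rows of `SL(2, ℤ)` integrated over the
standard domain, each row being met at most `w` times (`tsum_coset_rows_le`,
`energy_poincare_le`). So `M ^ 2 / ‖Q‖ ^ 2` is at least `M` over an explicit expression in a Gamma
value, and this is of the order `k ^ (3/2)` by a Stirling type bound (`exists_energyBound_le`,
`exists_poincare_lower`).

If no cusp has `k w` large, then the weight and all widths are bounded. Wohlfahrt's theorem
(`Gamma_le_of_conj_T_mem`) says that a congruence subgroup with widths dividing `N` (up to sign)
contains `Γ(N)`; so the volume of the fundamental domain is bounded, and any nonzero form does, as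
its norm is at most its supremum times the volume (`exists_lower_of_volume_le`).
-/

noncomputable section

open scoped Manifold
open UpperHalfPlane MeasureTheory Filter Topology
open Matrix.SpecialLinearGroup (mapGL)

namespace CuspSize

/-! ### The action of the modular group and the invariant measure -/

lemma measurableEmbedding_smul (g : SL(2, ℤ)) : MeasurableEmbedding (fun z : ℍ ↦ g • z) :=
  (Homeomorph.smul (mapGL ℝ g)).measurableEmbedding

lemma measurePreserving_smul (g : SL(2, ℤ)) :
    MeasurePreserving (fun z : ℍ ↦ g • z) volume volume :=
  MeasureTheory.measurePreserving_smul (mapGL ℝ g) volume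

lemma setLIntegral_smul (g : SL(2, ℤ)) (s : Set ℍ) (w : ℍ → ℝ≥0∞) :
    ∫⁻ z in g • s, w z = ∫⁻ z in s, w (g • z) :=
  ((measurePreserving_smul g).setLIntegral_comp_emb (measurableEmbedding_smul g) w s).symm

lemma measurableSet_fd : MeasurableSet ModularGroup.fd := ModularGroup.isClosed_fd.measurableSet

lemma measurableSet_smul (g : SL(2, ℤ)) {s : Set ℍ} (hs : MeasurableSet s) :
    MeasurableSet (g • s) :=
  (measurableEmbedding_smul g).measurableSet_image.mpr hs

lemma volume_eq_zero_of_coe {s : Set ℍ} (hs : volume ((↑) '' s : Set ℂ) = 0) : volume s = 0 := by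
  rw [volume_eq_lintegral]
  exact setLIntegral_measure_zero _ _ hs

lemma volume_re_eq (a : ℝ) : volume {z : ℂ | z.re = a} = 0 := by
  have h := Complex.volume_preserving_equiv_real_prod.measure_preimage
    (s := {a} ×ˢ Set.univ) (by measurability)
  rw [Measure.volume_eq_prod, Measure.prod_prod] at h
  simp only [Real.volume_singleton, zero_mul] at h
  convert h using 2
  ext z
  simp

lemma volume_fd_diff_fdo : volume (ModularGroup.fd \ ModularGroup.fdo) = 0 := by
  apply volume_eq_zero_of_coe
  have hsub : ((↑) '' (ModularGroup.fd \ ModularGroup.fdo) : Set ℂ) ⊆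
      Metric.sphere 0 1 ∪ ({z : ℂ | z.re = 1 / 2} ∪ {z : ℂ | z.re = -(1 / 2)}) := by
    rintro _ ⟨z, ⟨⟨h1, h2⟩, h3⟩, rfl⟩
    simp only [ModularGroup.fdo, Set.mem_ofPred_eq, not_and_or, not_lt] at h3
    rcases h3 with h3 | h3
    · left
      have : Complex.normSq (z : ℂ) = 1 := le_antisymm h3 h1
      rw [Complex.normSq_eq_norm_sq] at this
      simpa using (pow_eq_one_iff_of_nonneg (norm_nonneg _) two_ne_zero).mp this
    · right
      have : |z.re| = 1 / 2 := le_antisymm h2 h3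
      rcases abs_eq (by norm_num) |>.mp this with h | h
      · exact Or.inl h
      · exact Or.inr h
  refine measure_mono_null hsub (measure_union_null ?_ (measure_union_null ?_ ?_))
  · exact Measure.addHaar_sphere _ _ _
  · exact volume_re_eq _
  · exact volume_re_eq _

lemma volume_fd_inter_smul_fd {g : SL(2, ℤ)} (h1 : g ≠ 1) (h2 : g ≠ -1) :
    volume (ModularGroup.fd ∩ g • ModularGroup.fd) = 0 := by
  refine measure_mono_null ?_ volume_fd_diff_fdo
  rintro z ⟨hz, hgz⟩
  refine ⟨hz, fun hzo ↦ ?_⟩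
  rw [Set.mem_smul_set_iff_inv_smul_mem] at hgz
  rcases ModularGroup.eq_one_or_neg_one_of_mem_fdo_mem_fd hzo hgz with h | h
  · exact h1 (inv_eq_one.mp h)
  · exact h2 (by rw [← inv_inv g, h]; ext i j; fin_cases i <;> fin_cases j <;> simp)

lemma aedisjoint_smul_fd {g g' : SL(2, ℤ)} (h1 : g⁻¹ * g' ≠ 1) (h2 : g⁻¹ * g' ≠ -1) :
    AEDisjoint volume (g • ModularGroup.fd) (g' • ModularGroup.fd) := by
  have : g • ModularGroup.fd ∩ g' • ModularGroup.fd
      = g • (ModularGroup.fd ∩ (g⁻¹ * g') • ModularGroup.fd) := by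
    rw [Set.smul_set_inter, smul_smul, mul_inv_cancel_left]
  rw [AEDisjoint, this]
  have h := (measurePreserving_smul g).measure_preimage_emb (measurableEmbedding_smul g)
    (g • (ModularGroup.fd ∩ (g⁻¹ * g') • ModularGroup.fd))
  rw [← h, Set.preimage_smul, inv_smul_smul]
  exact volume_fd_inter_smul_fd h1 h2

/-! ### Cosets and the fundamental domain -/

/-- The subgroup `{±1} Γ`. -/
abbrev pm (Γ : Subgroup SL(2, ℤ)) : Subgroup SL(2, ℤ) :=
  Γ ⊔ Subgroup.zpowers (-1 : SL(2, ℤ))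

lemma mem_pm {Γ : Subgroup SL(2, ℤ)} {g : SL(2, ℤ)} : g ∈ pm Γ ↔ g ∈ Γ ∨ -g ∈ Γ := by
  constructor
  · intro h
    have hn : (Subgroup.zpowers (-1 : SL(2, ℤ))).Normal := by
      refine ⟨fun n hn g ↦ ?_⟩
      obtain ⟨m, rfl⟩ := Subgroup.mem_zpowers_iff.mp hn
      refine Subgroup.mem_zpowers_iff.mpr ⟨m, ?_⟩
      have : Commute (-1 : SL(2, ℤ)) g := by
        simp [Commute, SemiconjBy]
      rw [← (this.zpow_left m).eq]
      simp
    obtain ⟨a, ha, b, hb, rfl⟩ := Subgroup.mem_sup_of_normal_right.mp h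
    obtain ⟨m, rfl⟩ := Subgroup.mem_zpowers_iff.mp hb
    rcases m.even_or_odd with hm | hm
    · left; simpa [hm.neg_one_zpow] using ha
    · right; simpa [hm.neg_one_zpow] using ha
  · rintro (h | h)
    · exact Subgroup.mem_sup_left h
    · have := Subgroup.mul_mem (pm Γ) (Subgroup.mem_sup_left h)
        (Subgroup.mem_sup_right (Subgroup.mem_zpowers (-1 : SL(2, ℤ))))
      simpa using this

instance (Γ : Subgroup SL(2, ℤ)) [Γ.FiniteIndex] : (pm Γ).FiniteIndex :=
  Subgroup.finiteIndex_of_le le_sup_left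

/-- A function on `ℍ` is invariant under `Γ`. -/
def Invariant {α : Type*} (Γ : Subgroup SL(2, ℤ)) (w : ℍ → α) : Prop :=
  ∀ g ∈ Γ, ∀ z, w (g • z) = w z

lemma Invariant.pm {α : Type*} {Γ : Subgroup SL(2, ℤ)} {w : ℍ → α} (hw : Invariant Γ w) :
    Invariant (pm Γ) w := by
  intro g hg z
  rcases mem_pm.mp hg with h | h
  · exact hw g h z
  · rw [← hw (-g) h z, ModularGroup.SL_neg_smul]

/-- The integral of a `Γ`-invariant function over the translate of the standard fundamental domain
that belongs to the coset `q`. -/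
def cosetIntegral (Γ : Subgroup SL(2, ℤ)) (w : ℍ → ℝ≥0∞) (q : SL(2, ℤ) ⧸ pm Γ) : ℝ≥0∞ :=
  ∫⁻ z in ModularGroup.fd, w ((Quotient.out q)⁻¹ • z)

lemma cosetIntegral_mk {Γ : Subgroup SL(2, ℤ)} {w : ℍ → ℝ≥0∞} (hw : Invariant Γ w)
    (g : SL(2, ℤ)) : cosetIntegral Γ w (g : SL(2, ℤ) ⧸ pm Γ) =
      ∫⁻ z in ModularGroup.fd, w (g⁻¹ • z) := by
  obtain ⟨⟨h, hh⟩, hg⟩ := QuotientGroup.mk_out_eq_mul (pm Γ) g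
  unfold cosetIntegral
  have hg' : Quotient.out (g : SL(2, ℤ) ⧸ pm Γ) = g * h := hg
  rw [hg']
  simp only [mul_inv_rev, mul_smul, hw.pm h⁻¹ (inv_mem hh)]

lemma lintegral_fundDomain (Γ : Subgroup SL(2, ℤ)) [Γ.FiniteIndex] (w : ℍ → ℝ≥0∞) :
    ∫⁻ z in fundDomain Γ, w z = ∑' q, cosetIntegral Γ w q := by
  have : Finite (SL(2, ℤ) ⧸ (Γ ⊔ Subgroup.zpowers (-1 : SL(2, ℤ)))) :=
    (inferInstance : Finite (SL(2, ℤ) ⧸ pm Γ))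
  unfold fundDomain
  rw [lintegral_iUnion₀
    (fun q ↦ (measurableSet_smul _ measurableSet_fd).nullMeasurableSet)]
  · exact tsum_congr fun q ↦ setLIntegral_smul _ _ _
  · intro q q' hqq'
    have key : (Quotient.out q) * (Quotient.out q')⁻¹ ∈ ({1, -1} : Set SL(2, ℤ)) → q = q' := by
      rintro (h | h)
      · rw [mul_inv_eq_one] at h
        exact Quotient.out_injective h
      · have h : Quotient.out q = Quotient.out q' * (-1) := by
          rw [mul_inv_eq_iff_eq_mul.mp h]; simp
        rw [← QuotientGroup.out_eq' q, ← QuotientGroup.out_eq' q', QuotientGroup.eq, h]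
        rw [mul_inv_rev, inv_mul_cancel_right]
        exact inv_mem (mem_pm.mpr (Or.inr (by simp)))
    refine aedisjoint_smul_fd (fun h ↦ hqq' (key ?_)) (fun h ↦ hqq' (key ?_))
    · left; simpa using h
    · right; simpa using h

/-- The integral over one translate of the standard domain is at most the integral over a
fundamental domain. -/
lemma setLIntegral_smul_fd_le {Γ : Subgroup SL(2, ℤ)} [Γ.FiniteIndex] {w : ℍ → ℝ≥0∞}
    (hw : Invariant Γ w) (g : SL(2, ℤ)) :
    ∫⁻ z in g • ModularGroup.fd, w z ≤ ∫⁻ z in fundDomain Γ, w z := by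
  rw [lintegral_fundDomain, setLIntegral_smul]
  have := cosetIntegral_mk hw g⁻¹
  rw [inv_inv] at this
  rw [← this]
  exact ENNReal.le_tsum _

/-- The same for finitely many translates that lie in different cosets. -/
lemma sum_setLIntegral_smul_fd_le {Γ : Subgroup SL(2, ℤ)} [Γ.FiniteIndex] {w : ℍ → ℝ≥0∞}
    (hw : Invariant Γ w) {ι : Type*} (s : Finset ι) (g : ι → SL(2, ℤ))
    (hg : ∀ i ∈ s, ∀ j ∈ s, g i * (g j)⁻¹ ∈ pm Γ → i = j) :
    ∑ i ∈ s, ∫⁻ z in g i • ModularGroup.fd, w z ≤ ∫⁻ z in fundDomain Γ, w z := by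
  classical
  rw [lintegral_fundDomain]
  have h1 : ∀ i, ∫⁻ z in g i • ModularGroup.fd, w z =
      cosetIntegral Γ w ((g i)⁻¹ : SL(2, ℤ)) := fun i ↦ by
    rw [setLIntegral_smul, cosetIntegral_mk hw, inv_inv]
  simp_rw [h1]
  have hinj : Set.InjOn (fun i ↦ (((g i)⁻¹ : SL(2, ℤ)) : SL(2, ℤ) ⧸ pm Γ)) s := by
    intro i hi j hj hij
    exact hg i hi j hj (by simpa using QuotientGroup.eq.mp hij)
  rw [← Finset.sum_image (f := cosetIntegral Γ w) (fun i hi j hj h ↦ hinj hi hj h)]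
  exact ENNReal.sum_le_tsum _

/-- The conjugate `σ⁻¹ Γ σ`. -/
abbrev conj (σ : SL(2, ℤ)) (Γ : Subgroup SL(2, ℤ)) : Subgroup SL(2, ℤ) :=
  Γ.comap (MulAut.conj σ).toMonoidHom

lemma mem_conj {σ : SL(2, ℤ)} {Γ : Subgroup SL(2, ℤ)} {g : SL(2, ℤ)} :
    g ∈ conj σ Γ ↔ σ * g * σ⁻¹ ∈ Γ := by
  simp [conj]

lemma mem_pm_conj {σ : SL(2, ℤ)} {Γ : Subgroup SL(2, ℤ)} {g : SL(2, ℤ)} :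
    g ∈ pm (conj σ Γ) ↔ σ * g * σ⁻¹ ∈ pm Γ := by
  simp [mem_pm]

instance (σ : SL(2, ℤ)) (Γ : Subgroup SL(2, ℤ)) [Γ.FiniteIndex] : (conj σ Γ).FiniteIndex :=
  ⟨by
    rw [conj, Subgroup.index_comap_of_surjective _ (MulAut.conj σ).surjective]
    exact Subgroup.FiniteIndex.index_ne_zero⟩

/-- Change of variables by `σ` in an integral over a fundamental domain. -/
lemma lintegral_fundDomain_conj {Γ : Subgroup SL(2, ℤ)} [Γ.FiniteIndex] {w : ℍ → ℝ≥0∞}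
    (hw : Invariant Γ w) (σ : SL(2, ℤ)) :
    ∫⁻ z in fundDomain (conj σ Γ), w (σ • z) = ∫⁻ z in fundDomain Γ, w z := by
  rw [lintegral_fundDomain, lintegral_fundDomain]
  let e : SL(2, ℤ) ⧸ pm (conj σ Γ) → SL(2, ℤ) ⧸ pm Γ :=
    fun q ↦ ((Quotient.out q * σ⁻¹ : SL(2, ℤ)) : SL(2, ℤ) ⧸ pm Γ)
  have he : Function.Bijective e := by
    constructor
    · intro q q' h
      have h := QuotientGroup.eq.mp h
      rw [← QuotientGroup.out_eq' q, ← QuotientGroup.out_eq' q', QuotientGroup.eq, mem_pm_conj]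
      simpa [mul_assoc] using h
    · intro q
      induction q using QuotientGroup.induction_on with
      | H g =>
        refine ⟨((g * σ : SL(2, ℤ)) : SL(2, ℤ) ⧸ pm (conj σ Γ)), ?_⟩
        obtain ⟨⟨h, hh⟩, hg⟩ := QuotientGroup.mk_out_eq_mul (pm (conj σ Γ)) (g * σ)
        have hg' : Quotient.out ((g * σ : SL(2, ℤ)) : SL(2, ℤ) ⧸ pm (conj σ Γ)) = g * σ * h := hg
        simp only [e, hg']
        refine QuotientGroup.eq.mpr ?_
        have := inv_mem (mem_pm_conj.mp hh)
        simpa [mul_assoc] using this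
  rw [← (Equiv.ofBijective e he).tsum_eq]
  refine tsum_congr fun q ↦ ?_
  rw [Equiv.ofBijective_apply, cosetIntegral_mk hw, cosetIntegral]
  simp only [mul_inv_rev, inv_inv, mul_smul]

/-! ### Integration on the upper half-plane -/

/-- An integral over a subset of `ℍ` as a Lebesgue integral in the plane. -/
lemma setLIntegral_coe {s : Set ℍ} (hs : MeasurableSet s) (W : ℂ → ℝ≥0∞) :
    ∫⁻ z in s, W z = ∫⁻ ζ in (↑) '' s, ENNReal.ofReal (1 / ζ.im ^ 2) * W ζ := by
  have h1 : MeasurePreserving UpperHalfPlane.coe (volume.comap UpperHalfPlane.coe)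
      (volume.restrict (.range UpperHalfPlane.coe)) :=
    ⟨measurable_coe, by rw [measurableEmbedding_coe.map_comap]⟩
  have hd : ∀ z : ℍ, (((1 / NNReal.mk z.im z.im_pos.le : NNReal) ^ 2 : NNReal) : ℝ≥0∞) =
      ENNReal.ofReal (1 / (z : ℂ).im ^ 2) := by
    intro z
    rw [ENNReal.ofReal, ENNReal.coe_inj]
    apply NNReal.eq
    rw [Real.coe_toNNReal _ (by positivity)]
    simp
  have hdm : Measurable fun z : ℍ ↦ ENNReal.ofReal (1 / (z : ℂ).im ^ 2) := by
    have := measurable_coe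
    fun_prop
  rw [volume_def]
  simp_rw [hd]
  rw [setLIntegral_withDensity_eq_setLIntegral_mul_non_measurable _ hdm _ hs
    (Eventually.of_forall fun z ↦ ENNReal.ofReal_lt_top),
    ← Set.inter_eq_self_of_subset_left (Set.image_subset_range UpperHalfPlane.coe s),
    ← Measure.restrict_restrict', ← h1.setLIntegral_comp_emb measurableEmbedding_coe]
  · rfl
  · exact measurableEmbedding_coe.measurableSet_range

/-! ### A weighted mean value inequality -/

lemma enorm_center_le_lintegral_circle {g : ℂ → ℂ} {c : ℂ} {ρ : ℝ} (hρ : 0 < ρ)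
    (hg : DiffContOnCl ℂ g (Metric.ball c ρ)) :
    ENNReal.ofReal (2 * Real.pi) * ‖g c‖ₑ ≤
      ∫⁻ θ in Set.Ioo (-Real.pi) Real.pi, ‖g (circleMap c ρ θ)‖ₑ := by
  have h1 : Real.circleAverage g c ρ = g c := by
    apply DiffContOnCl.circleAverage
    rwa [abs_of_pos hρ]
  rw [Real.circleAverage_eq_integral_add (-Real.pi),
    intervalIntegral.integral_comp_add_right (fun θ ↦ g (circleMap c ρ θ))] at h1
  have h2 : (2 * Real.pi) • g c = ∫ θ in (-Real.pi)..Real.pi, g (circleMap c ρ θ) := by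
    rw [← h1, smul_smul, mul_inv_cancel₀ (by positivity), one_smul]
    congr 1 <;> ring
  have h3 : ENNReal.ofReal (2 * Real.pi) * ‖g c‖ₑ = ‖(2 * Real.pi) • g c‖ₑ := by
    rw [enorm_smul, Real.enorm_eq_ofReal (by positivity)]
  rw [h3, h2, intervalIntegral.integral_of_le (by linarith [Real.pi_pos]),
    integral_Ioc_eq_integral_Ioo]
  exact enorm_integral_le_lintegral_enorm _

lemma lintegral_Ioo_ofReal {r : ℝ} (hr : 0 < r) :
    ∫⁻ ρ in Set.Ioo 0 r, ENNReal.ofReal ρ = ENNReal.ofReal (r ^ 2 / 2) := by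
  rw [restrict_Ioo_eq_restrict_Ioc, ← ofReal_integral_eq_lintegral_ofReal]
  · rw [← intervalIntegral.integral_of_le hr.le, integral_id]
    congr 1; ring
  · exact (continuous_id.integrableOn_Icc (a := 0) (b := r)).mono_set Set.Ioc_subset_Icc_self
  · filter_upwards [ae_restrict_mem measurableSet_Ioc] with x hx using hx.1.le

/-- The mean value inequality on a disc. -/
lemma enorm_center_le_lintegral_ball {g : ℂ → ℂ} {c : ℂ} {r : ℝ} (hr : 0 < r)
    (hg : DifferentiableOn ℂ g (Metric.ball c r)) :
    ENNReal.ofReal (Real.pi * r ^ 2) * ‖g c‖ₑ ≤ ∫⁻ ζ in Metric.ball c r, ‖g ζ‖ₑ := by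
  rw [← lintegral_indicator Metric.isOpen_ball.measurableSet,
    ← lintegral_add_left_eq_self _ c, ← Complex.lintegral_comp_polarCoord_symm]
  have hsub : Set.Ioo 0 r ×ˢ Set.Ioo (-Real.pi) Real.pi ⊆ polarCoord.target := by
    intro p hp
    exact ⟨hp.1.1, hp.2⟩
  have hcirc : ∀ p : ℝ × ℝ, c + Complex.polarCoord.symm p = circleMap c p.1 p.2 := by
    intro p
    rw [Complex.polarCoord_symm_apply, circleMap, Complex.exp_mul_I, Complex.ofReal_cos,
      Complex.ofReal_sin]
  have hmem : ∀ p ∈ Set.Ioo 0 r ×ˢ Set.Ioo (-Real.pi) Real.pi,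
      circleMap c p.1 p.2 ∈ Metric.ball c r := by
    intro p hp
    rw [Metric.mem_ball, dist_eq_norm]
    simpa [circleMap, abs_of_pos hp.1.1] using hp.1.2
  calc ENNReal.ofReal (Real.pi * r ^ 2) * ‖g c‖ₑ
      = ∫⁻ ρ in Set.Ioo 0 r, ENNReal.ofReal ρ * (ENNReal.ofReal (2 * Real.pi) * ‖g c‖ₑ) := by
        rw [lintegral_mul_const' _ _ (ENNReal.mul_ne_top ENNReal.ofReal_ne_top enorm_ne_top),
          lintegral_Ioo_ofReal hr, ← mul_assoc, ← ENNReal.ofReal_mul (by positivity)]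
        congr 2; ring
    _ ≤ ∫⁻ ρ in Set.Ioo 0 r, ENNReal.ofReal ρ *
          ∫⁻ θ in Set.Ioo (-Real.pi) Real.pi, ‖g (circleMap c ρ θ)‖ₑ := by
        refine setLIntegral_mono_ae' measurableSet_Ioo (Eventually.of_forall fun ρ hρ ↦ ?_)
        gcongr
        refine enorm_center_le_lintegral_circle hρ.1 (hg.diffContOnCl_ball ?_)
        exact Metric.closedBall_subset_ball hρ.2
    _ = ∫⁻ ρ in Set.Ioo 0 r, ∫⁻ θ in Set.Ioo (-Real.pi) Real.pi,
          ENNReal.ofReal ρ * ‖g (circleMap c ρ θ)‖ₑ := by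
        refine lintegral_congr fun ρ ↦ ?_
        rw [lintegral_const_mul' _ _ ENNReal.ofReal_ne_top]
    _ = ∫⁻ p in Set.Ioo 0 r ×ˢ Set.Ioo (-Real.pi) Real.pi,
          ENNReal.ofReal p.1 * ‖g (circleMap c p.1 p.2)‖ₑ := by
        rw [Measure.volume_eq_prod, setLIntegral_prod]
        refine AEMeasurable.mul measurable_fst.ennreal_ofReal.aemeasurable ?_
        refine AEMeasurable.enorm ?_
        refine ContinuousOn.aemeasurable ?_ (measurableSet_Ioo.prod measurableSet_Ioo)
        refine hg.continuousOn.comp ?_ hmem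
        exact Continuous.continuousOn (by unfold circleMap; fun_prop)
    _ ≤ _ := by
        refine le_trans ?_ (lintegral_mono_set hsub)
        refine setLIntegral_mono_ae' (measurableSet_Ioo.prod measurableSet_Ioo)
          (Eventually.of_forall fun p hp ↦ ?_)
        rw [hcirc, Set.indicator_of_mem (hmem p hp), smul_eq_mul]

/-- The invariant squared absolute value `y ^ k |f(z)| ^ 2`. -/
def pnorm (k : ℤ) (f : ℍ → ℂ) (z : ℍ) : ℝ := z.im ^ k * ‖f z‖ ^ 2

lemma pnorm_nonneg (k : ℤ) (f : ℍ → ℂ) (z : ℍ) : 0 ≤ pnorm k f z :=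
  mul_nonneg (zpow_nonneg z.im_pos.le _) (sq_nonneg _)

lemma petersson_self (k : ℤ) (f : ℍ → ℂ) (z : ℍ) : petersson k f f z = (pnorm k f z : ℂ) := by
  rw [petersson, ← Complex.normSq_eq_conj_mul_self, Complex.normSq_eq_norm_sq, pnorm, mul_comm]
  push_cast
  rfl

lemma pnorm_slash (k : ℤ) (f : ℍ → ℂ) (g : SL(2, ℤ)) (z : ℍ) :
    pnorm k (f ∣[k] g) z = pnorm k f (g • z) := by
  have := petersson_slash_SL k f f g z
  rw [petersson_self, petersson_self] at this
  exact_mod_cast this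

/-- The second order term `k t ^ 2` of `k log (1 + t)` is at most `1 / 4` on the given range. -/
lemma exp_le_two_mul_zpow {k : ℤ} (hk : 1 ≤ k) {t : ℝ} (ht : |t| * (2 * √k) ≤ 1) :
    Real.exp (k * t) ≤ 2 * (1 + t) ^ k := by
  have hk' : (1 : ℝ) ≤ k := by exact_mod_cast hk
  have hs : 1 ≤ √(k : ℝ) := Real.one_le_sqrt.mpr hk'
  have ht1 : |t| ≤ 1 / 2 := by nlinarith [abs_nonneg t]
  have ht2 : k * t ^ 2 ≤ 1 / 4 := by
    have h : (|t| * (2 * √k)) ^ 2 ≤ 1 := pow_le_one₀ (by positivity) ht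
    rw [mul_pow, mul_pow, sq_abs, Real.sq_sqrt (by linarith)] at h
    linarith
  obtain ⟨h1, h2⟩ := abs_le.mp ht1
  have hpos : 0 < 1 + t := by linarith
  have hlog : t - 2 * t ^ 2 ≤ Real.log (1 + t) := by
    refine le_trans ?_ (Real.one_sub_inv_le_log_of_pos hpos)
    rw [← sub_nonneg]
    have : 1 - (1 + t)⁻¹ - (t - 2 * t ^ 2) = t ^ 2 * (1 + 2 * t) / (1 + t) := by
      field_simp; ring
    rw [this]
    have : 0 ≤ 1 + 2 * t := by linarith
    positivity
  have hexp : Real.exp (1 / 2) ≤ 2 := by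
    have h := Real.exp_one_lt_d9
    have h3 : Real.exp (1 / 2) ^ 2 = Real.exp 1 := by
      rw [← Real.exp_nat_mul]; norm_num
    nlinarith [Real.exp_pos (1 / 2 : ℝ)]
  have hz : (1 + t) ^ k = Real.exp (k * Real.log (1 + t)) := by
    rw [← Real.rpow_intCast, Real.rpow_def_of_pos hpos, mul_comm]
  calc Real.exp (k * t) ≤ Real.exp (1 / 2 + k * Real.log (1 + t)) := by
        apply Real.exp_le_exp.mpr
        nlinarith
    _ = Real.exp (1 / 2) * (1 + t) ^ k := by rw [Real.exp_add, hz]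
    _ ≤ 2 * (1 + t) ^ k := by gcongr

/-- The Euclidean disc in `ℍ` of radius `y / (2 √k)` about `z`, where `y` is the height of `z`. -/
def disc (k : ℤ) (z : ℍ) : Set ℍ := {w | ‖(w : ℂ) - z‖ < z.im / (2 * √k)}

lemma isOpen_disc (k : ℤ) (z : ℍ) : IsOpen (disc k z) :=
  isOpen_lt (by fun_prop) continuous_const

lemma radius_le {k : ℤ} (hk : 1 ≤ k) (z : ℍ) : z.im / (2 * √k) ≤ z.im / 2 := by
  have hs : 1 ≤ √(k : ℝ) := Real.one_le_sqrt.mpr (by exact_mod_cast hk)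
  have := z.im_pos
  gcongr
  linarith

lemma coe_disc {k : ℤ} (hk : 1 ≤ k) (z : ℍ) :
    ((↑) '' disc k z : Set ℂ) = Metric.ball (z : ℂ) (z.im / (2 * √k)) := by
  ext ζ
  constructor
  · rintro ⟨w, hw, rfl⟩
    rwa [Metric.mem_ball, dist_eq_norm]
  · intro h
    rw [Metric.mem_ball, dist_eq_norm] at h
    have h1 : |(ζ - z).im| ≤ _ := (Complex.abs_im_le_norm _)
    have h2 := radius_le hk z
    have h3 : 0 < ζ.im := by
      rw [Complex.sub_im, coe_im] at h1
      linarith [(abs_le.mp h1).1, z.im_pos]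
    exact ⟨⟨ζ, h3⟩, h, rfl⟩

/-- The weighted mean value inequality. On the disc the weight `y ^ k` agrees up to a bounded factor
with `exp (k Im w / y)`, the squared absolute value of a holomorphic function. -/
lemma pnorm_le_lintegral_disc {k : ℤ} (hk : 1 ≤ k) {f : ℍ → ℂ} (hf : MDiff f) (z : ℍ) :
    ENNReal.ofReal (pnorm k f z) ≤
      ENNReal.ofReal (6 * k) * ∫⁻ w in disc k z, ENNReal.ofReal (pnorm k f w) := by
  have hk' : (1 : ℝ) ≤ k := by exact_mod_cast hk
  have hs : 1 ≤ √(k : ℝ) := Real.one_le_sqrt.mpr hk'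
  set y := z.im with hy
  have hy0 : 0 < y := z.im_pos
  set r := y / (2 * √k) with hr
  have hr0 : 0 < r := by positivity
  have hry : r ≤ y / 2 := radius_le hk z
  let F : ℂ → ℂ := f ∘ ofComplex
  let g : ℂ → ℂ := fun ζ ↦ (F ζ * Complex.exp (-Complex.I * k * (ζ - z) / (2 * y))) ^ 2
  have him : ∀ ζ ∈ Metric.ball (z : ℂ) r, |ζ.im - y| < r := by
    intro ζ h
    rw [Metric.mem_ball, dist_eq_norm] at h
    have h1 : |(ζ - z).im| ≤ _ := (Complex.abs_im_le_norm _)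
    rw [Complex.sub_im, coe_im] at h1
    linarith
  have hg : DifferentiableOn ℂ g (Metric.ball (z : ℂ) r) := by
    have h1 : DifferentiableOn ℂ F (Metric.ball (z : ℂ) r) := by
      refine (UpperHalfPlane.mdifferentiable_iff.mp hf).mono fun ζ hζ ↦ ?_
      have := (abs_lt.mp (him ζ hζ)).1
      change 0 < ζ.im
      linarith
    have h2 : DifferentiableOn ℂ
        (fun ζ : ℂ ↦ Complex.exp (-Complex.I * k * (ζ - z) / (2 * y))) (Metric.ball (z : ℂ) r) := by
      fun_prop
    exact (h1.mul h2).pow 2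
  have hgc : ‖g z‖ₑ = ENNReal.ofReal (‖f z‖ ^ 2) := by
    rw [← ofReal_norm]
    simp [g, F]
  have hgb : ∀ ζ ∈ Metric.ball (z : ℂ) r, ‖g ζ‖ₑ ≤ ENNReal.ofReal (9 / 2 * y ^ 2 / y ^ k) *
      (ENNReal.ofReal (1 / ζ.im ^ 2) * ENNReal.ofReal (pnorm k f (ofComplex ζ))) := by
    intro ζ hζ
    have h1 := him ζ hζ
    have hζ0 : 0 < ζ.im := by have := (abs_lt.mp h1).1; linarith
    have hζ1 : ζ.im ≤ 3 / 2 * y := by have := (abs_lt.mp h1).2; linarith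
    rw [← ENNReal.ofReal_mul (by positivity), ← ENNReal.ofReal_mul (by positivity),
      ← ofReal_norm]
    apply ENNReal.ofReal_le_ofReal
    have hre : (-Complex.I * k * (ζ - z) / (2 * y)).re = k * ((ζ.im - y) / y) / 2 := by
      have : (-Complex.I * k * (ζ - z) / (2 * y)) =
        ((k / (2 * y) : ℝ) : ℂ) * (-Complex.I * (ζ - z)) := by push_cast; ring
      rw [this, Complex.re_ofReal_mul]
      simp [hy]
      ring
    have hnorm : ‖g ζ‖ = ‖F ζ‖ ^ 2 * Real.exp (k * ((ζ.im - y) / y)) := by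
      simp only [g, norm_pow, norm_mul, mul_pow, Complex.norm_exp, hre]
      rw [← Real.exp_nat_mul]
      congr 2
      push_cast; ring
    have ht : |(ζ.im - y) / y| * (2 * √k) ≤ 1 := by
      rw [abs_div, abs_of_pos hy0, div_mul_eq_mul_div, div_le_one hy0]
      have : r * (2 * √k) = y := by rw [hr]; field_simp
      nlinarith
    have hexp := exp_le_two_mul_zpow hk ht
    have h1t : 1 + (ζ.im - y) / y = ζ.im / y := by field_simp; ring
    rw [h1t, div_zpow] at hexp
    have hp : pnorm k f (ofComplex ζ) = ζ.im ^ k * ‖F ζ‖ ^ 2 := by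
      rw [pnorm, ofComplex_apply_of_im_pos hζ0]
      simp [F, ofComplex_apply_of_im_pos hζ0]
    rw [hnorm, hp]
    have hyk : 0 < y ^ k := zpow_pos hy0 k
    have hζk : 0 < ζ.im ^ k := zpow_pos hζ0 k
    have hq : 2 ≤ 9 / 2 * y ^ 2 * (1 / ζ.im ^ 2) := by
      rw [mul_one_div, le_div_iff₀ (by positivity)]
      nlinarith
    calc ‖F ζ‖ ^ 2 * Real.exp (k * ((ζ.im - y) / y))
        ≤ ‖F ζ‖ ^ 2 * (2 * (ζ.im ^ k / y ^ k)) := by gcongr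
      _ ≤ ‖F ζ‖ ^ 2 * ((9 / 2 * y ^ 2 * (1 / ζ.im ^ 2)) * (ζ.im ^ k / y ^ k)) := by gcongr
      _ = _ := by ring
  have hmv := enorm_center_le_lintegral_ball hr0 hg
  have hint : ∫⁻ ζ in Metric.ball (z : ℂ) r, ‖g ζ‖ₑ ≤ ENNReal.ofReal (9 / 2 * y ^ 2 / y ^ k) *
      ∫⁻ w in disc k z, ENNReal.ofReal (pnorm k f w) := by
    have := setLIntegral_coe (isOpen_disc k z).measurableSet
      (fun ζ ↦ ENNReal.ofReal (pnorm k f (ofComplex ζ)))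
    simp only [ofComplex_apply] at this
    rw [this, coe_disc hk, ← lintegral_const_mul' _ _ ENNReal.ofReal_ne_top]
    exact setLIntegral_mono_ae' Metric.isOpen_ball.measurableSet (Eventually.of_forall hgb)
  have hmain := hmv.trans hint
  rw [hgc] at hmain
  have hyk : 0 < y ^ k := zpow_pos hy0 k
  have hpi := Real.pi_gt_three
  have h1 : ENNReal.ofReal (pnorm k f z) = ENNReal.ofReal (y ^ k / (Real.pi * r ^ 2)) *
      (ENNReal.ofReal (Real.pi * r ^ 2) * ENNReal.ofReal (‖f z‖ ^ 2)) := by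
    rw [← ENNReal.ofReal_mul (by positivity), ← ENNReal.ofReal_mul (by positivity), pnorm]
    congr 1
    field_simp
    rw [← hy, mul_comm]
  rw [h1]
  calc _ ≤ ENNReal.ofReal (y ^ k / (Real.pi * r ^ 2)) * (ENNReal.ofReal (9 / 2 * y ^ 2 / y ^ k) *
      ∫⁻ w in disc k z, ENNReal.ofReal (pnorm k f w)) := by gcongr
    _ ≤ _ := by
      rw [← mul_assoc, ← ENNReal.ofReal_mul (by positivity)]
      refine mul_le_mul_left (ENNReal.ofReal_le_ofReal ?_) _
      have : y ^ k / (Real.pi * r ^ 2) * (9 / 2 * y ^ 2 / y ^ k) = 18 * k / Real.pi := by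
        rw [hr, div_pow, mul_pow, Real.sq_sqrt (by linarith)]
        field_simp
        ring
      rw [this, div_le_iff₀ (by positivity)]
      nlinarith

/-! ### The upper bound for a single form -/

/-- The squared Petersson norm, as an element of `[0, ∞]`. -/
def energy (Γ : Subgroup SL(2, ℤ)) (k : ℤ) (f : ℍ → ℂ) : ℝ≥0∞ :=
  ∫⁻ z in fundDomain Γ, ENNReal.ofReal (pnorm k f z)

lemma invariant_pnorm {Γ : Subgroup SL(2, ℤ)} {k : ℤ} {f : ℍ → ℂ} (hf : ∀ γ ∈ Γ, f ∣[k] γ = f) :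
    Invariant Γ (pnorm k f) :=
  fun g hg z ↦ by rw [← pnorm_slash, hf g hg]

lemma invariant_ofReal_pnorm {Γ : Subgroup SL(2, ℤ)} {k : ℤ} {f : ℍ → ℂ}
    (hf : ∀ γ ∈ Γ, f ∣[k] γ = f) : Invariant Γ (fun z ↦ ENNReal.ofReal (pnorm k f z)) :=
  fun g hg z ↦ congrArg ENNReal.ofReal (invariant_pnorm hf g hg z)

lemma isCompact_re_im_Icc {a b c d : ℝ} (hc : 0 < c) :
    IsCompact {w : ℍ | w.re ∈ Set.Icc a b ∧ w.im ∈ Set.Icc c d} := by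
  rw [isEmbedding_coe.isCompact_iff]
  convert (isCompact_Icc (a := a) (b := b)).reProdIm (isCompact_Icc (a := c) (b := d)) using 1
  ext ζ
  constructor
  · rintro ⟨w, hw, rfl⟩
    exact hw
  · intro h
    exact ⟨⟨ζ, hc.trans_le h.2.1⟩, h, rfl⟩

/-- A compact set is covered by finitely many translates of the standard fundamental domain. -/
lemma exists_finset_cover {K : Set ℍ} (hK : IsCompact K) {B : ℝ}
    (hB : ∀ w ∈ K, w.im ≤ B ∧ 1 / w.im ≤ B) :
    ∃ G : Finset SL(2, ℤ), ∀ w ∈ K, ∃ g ∈ G, w ∈ g • ModularGroup.fd := by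
  have hL := ModularGroup.isCompact_truncatedFundamentalDomain B
  have hfin := ProperlyDiscontinuousSMul.finite_disjoint_inter_image
    (Γ := (mapGL ℝ : SL(2, ℤ) →* GL (Fin 2) ℝ).range) hK hL
  have hinj : Function.Injective
      (fun g : SL(2, ℤ) ↦ (mapGL ℝ : SL(2, ℤ) →* GL (Fin 2) ℝ).rangeRestrict g⁻¹) := by
    intro g g' h
    have := Matrix.SpecialLinearGroup.mapGL_injective (congrArg Subtype.val h)
    exact inv_injective this
  refine ⟨(hfin.preimage hinj.injOn).toFinset, fun w hw ↦ ?_⟩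
  obtain ⟨g, hg⟩ := ModularGroup.exists_smul_mem_fd w
  refine ⟨g⁻¹, ?_, Set.mem_smul_set_iff_inv_smul_mem.mpr (by rwa [inv_inv])⟩
  rw [Set.Finite.mem_toFinset]
  refine ⟨g • w, ⟨w, hw, by simp only [inv_inv]; rfl⟩, hg, ?_⟩
  rw [ModularGroup.im_smul_eq_div_normSq, ModularGroup.denom_apply, Complex.normSq_apply]
  have hy := w.im_pos
  obtain ⟨h1, h2⟩ := hB w hw
  simp only [Complex.add_re, Complex.add_im, Complex.mul_re, Complex.mul_im, Complex.intCast_re,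
    Complex.intCast_im, coe_re, coe_im, zero_mul, sub_zero, add_zero]
  by_cases hc : (g 1 0 : ℤ) = 0
  · have hd : (g 1 1 : ℤ) ≠ 0 := by
      intro h
      have := g.det_coe
      rw [Matrix.det_fin_two, hc, h] at this
      simp at this
    have : (1 : ℝ) ≤ (g 1 1 : ℝ) ^ 2 := by
      exact_mod_cast (one_le_sq_iff_one_le_abs _).mpr (Int.one_le_abs hd)
    rw [hc]
    refine le_trans ?_ h1
    simp only [Int.cast_zero, zero_mul, zero_add, add_zero, mul_zero]
    exact div_le_self hy.le (by nlinarith)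
  · have : (1 : ℝ) ≤ (g 1 0 : ℝ) ^ 2 := by
      exact_mod_cast (one_le_sq_iff_one_le_abs _).mpr (Int.one_le_abs hc)
    refine le_trans ?_ h2
    rw [div_le_div_iff₀ (by nlinarith [sq_nonneg ((g 1 0 : ℝ) * w.re + g 1 1), sq_pos_of_pos hy])
      hy]
    nlinarith [sq_nonneg ((g 1 0 : ℝ) * w.re + g 1 1), sq_pos_of_pos hy]

lemma abs_sub_lt_of_mem_disc {k : ℤ} {z w : ℍ} (hw : w ∈ disc k z) :
    |w.re - z.re| < z.im / (2 * √k) ∧ |w.im - z.im| < z.im / (2 * √k) := by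
  have h1 := Complex.abs_re_le_norm ((w : ℂ) - z)
  have h2 := Complex.abs_im_le_norm ((w : ℂ) - z)
  rw [Complex.sub_re, coe_re, coe_re] at h1
  rw [Complex.sub_im, coe_im, coe_im] at h2
  exact ⟨h1.trans_lt hw, h2.trans_lt hw⟩

lemma lintegral_biUnion_finset_le {ι : Type*} (G : Finset ι) (t : ι → Set ℍ) (u : ℍ → ℝ≥0∞) :
    ∫⁻ w in ⋃ g ∈ G, t g, u w ≤ ∑ g ∈ G, ∫⁻ w in t g, u w := by
  classical
  induction G using Finset.induction_on with
  | empty => simp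
  | insert a G ha ih =>
    rw [Finset.set_biUnion_insert, Finset.sum_insert ha]
    exact (lintegral_union_le _ _ _).trans (by gcongr)

lemma setLIntegral_le_sum {s : Set ℍ} {ι : Type*} (G : Finset ι) (t : ι → Set ℍ)
    (h : ∀ w ∈ s, ∃ g ∈ G, w ∈ t g) (u : ℍ → ℝ≥0∞) :
    ∫⁻ w in s, u w ≤ ∑ g ∈ G, ∫⁻ w in t g, u w := by
  refine (lintegral_mono_set (t := ⋃ g ∈ G, t g) fun w hw ↦ ?_).trans
    (lintegral_biUnion_finset_le G t u)
  obtain ⟨g, hg, hw⟩ := h w hw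
  exact Set.mem_biUnion hg hw

/-- Points of bounded height in the standard fundamental domain: the disc of the mean value
inequality meets a bounded number of translates of the domain. -/
lemma exists_pnorm_le_of_im_le_two : ∃ C : ℝ, 0 < C ∧ ∀ (Γ : Subgroup SL(2, ℤ)) [Γ.FiniteIndex]
    (k : ℤ), 1 ≤ k → ∀ f : ℍ → ℂ, MDiff f → (∀ γ ∈ Γ, f ∣[k] γ = f) →
    ∀ z ∈ ModularGroup.fd, z.im ≤ 2 →
    ENNReal.ofReal (pnorm k f z) ≤ ENNReal.ofReal (C * k) * energy Γ k f := by
  obtain ⟨G, hG⟩ := exists_finset_cover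
    (isCompact_re_im_Icc (a := -2) (b := 2) (c := 1 / 4) (d := 4) (by norm_num)) (B := 4) (by
      rintro w ⟨-, h1, h2⟩
      refine ⟨h2, ?_⟩
      rw [div_le_iff₀ w.im_pos]
      linarith)
  refine ⟨6 * G.card + 1, by positivity, fun Γ _ k hk f hf hΓ z hz hz2 ↦ ?_⟩
  have hk' : (1 : ℝ) ≤ k := by exact_mod_cast hk
  refine (pnorm_le_lintegral_disc hk hf z).trans ?_
  have hint : ∫⁻ w in disc k z, ENNReal.ofReal (pnorm k f w) ≤ G.card * energy Γ k f := by
    refine (setLIntegral_le_sum G (fun g ↦ g • ModularGroup.fd) (fun w hw ↦ hG w ?_) _).trans ?_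
    · obtain ⟨h1, h2⟩ := abs_sub_lt_of_mem_disc hw
      have h3 := radius_le hk z
      have h4 := ModularGroup.three_le_four_mul_im_sq_of_mem_fd hz
      have h5 := z.im_pos
      have h6 := abs_le.mp hz.2
      rw [abs_lt] at h1 h2
      have h7 : 1 / 2 ≤ z.im := by nlinarith
      refine ⟨⟨?_, ?_⟩, ⟨?_, ?_⟩⟩ <;> linarith [h6.1, h6.2, h1.1, h1.2, h2.1, h2.2]
    · refine (Finset.sum_le_sum fun g _ ↦
        setLIntegral_smul_fd_le (invariant_ofReal_pnorm hΓ) g).trans ?_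
      rw [Finset.sum_const, nsmul_eq_mul]
      rfl
  calc _ ≤ ENNReal.ofReal (6 * k) * (G.card * energy Γ k f) := by gcongr
    _ = ENNReal.ofReal (6 * G.card * k) * energy Γ k f := by
      rw [← mul_assoc, ← ENNReal.ofReal_natCast, ← ENNReal.ofReal_mul (by positivity)]
      congr 2; ring
    _ ≤ _ := by gcongr; linarith

/-- Points of height at least `2`: the disc of the mean value inequality is covered by translates
`Tⁿ 𝒟`, and any `h` consecutive ones are inequivalent if `h` is the width of the cusp. -/
lemma pnorm_le_of_two_le_im {Γ : Subgroup SL(2, ℤ)} [Γ.FiniteIndex] {k : ℤ} (hk : 1 ≤ k)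
    {f : ℍ → ℂ} (hf : MDiff f) (hΓ : ∀ γ ∈ Γ, f ∣[k] γ = f) {h : ℕ} (h0 : 0 < h)
    (hh : ∀ m : ℤ, ModularGroup.T ^ m ∈ pm Γ → (h : ℤ) ∣ m) {z : ℍ} (hz : 2 ≤ z.im) :
    ENNReal.ofReal (pnorm k f z) ≤
      ENNReal.ofReal (6 * k * (z.im / (h * √k) + 3)) * energy Γ k f := by
  have hk' : (1 : ℝ) ≤ k := by exact_mod_cast hk
  have hs : 1 ≤ √(k : ℝ) := Real.one_le_sqrt.mpr hk'
  have hh0 : (1 : ℝ) ≤ h := by exact_mod_cast h0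
  have hz0 := z.im_pos
  refine (pnorm_le_lintegral_disc hk hf z).trans ?_
  set R := z.im / (2 * √k) with hR
  have hR0 : 0 < R := by positivity
  have hRz : R ≤ z.im / 2 := radius_le hk z
  set n₀ : ℤ := ⌊z.re - R - 1 / 2⌋ with hn0
  set m : ℕ := ⌊(2 * R + 2) / h⌋₊ + 1 with hm
  have hcover : ∀ w ∈ disc k z, ∃ j ∈ Finset.range m, w ∈ ⋃ i ∈ Finset.range h,
      (ModularGroup.T ^ (n₀ + h * j + i : ℤ)) • ModularGroup.fd := by
    intro w hw
    obtain ⟨h1, h2⟩ := abs_sub_lt_of_mem_disc hw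
    rw [abs_lt] at h1 h2
    have hr := abs_sub_round w.re
    rw [abs_le] at hr
    have h3 : n₀ ≤ round w.re := by
      rw [hn0, Int.floor_le_iff]
      linarith [hr.1, hr.2, h1.1]
    obtain ⟨N, hN⟩ := Int.le.dest h3
    have hNR : (N : ℝ) ≤ 2 * R + 2 := by
      have h4 : ((n₀ + N : ℤ) : ℝ) = round w.re := by rw [hN]
      push_cast at h4
      have h5 := Int.lt_floor_add_one (z.re - R - 1 / 2)
      rw [← hn0] at h5
      linarith [hr.1, h1.2]
    refine ⟨N / h, ?_, Set.mem_biUnion (x := N % h) ?_ ?_⟩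
    · rw [Finset.mem_range, hm, Nat.lt_succ_iff]
      apply Nat.le_floor
      exact Nat.cast_div_le.trans (by gcongr)
    · exact Finset.mem_range.mpr (Nat.mod_lt _ h0)
    · have h4 : (n₀ + h * (N / h : ℕ) + (N % h : ℕ) : ℤ) = round w.re := by
        rw [← hN, add_assoc]
        congr 1
        exact_mod_cast Nat.div_add_mod N h
      rw [h4, Set.mem_smul_set_iff_inv_smul_mem, ← zpow_neg]
      have hwim : 1 < w.im := by linarith [h2.1]
      have hre := ModularGroup.re_T_zpow_smul w (-round w.re)
      have him := ModularGroup.im_T_zpow_smul w (-round w.re)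
      constructor
      · rw [Complex.normSq_apply, coe_im, him]
        nlinarith [mul_self_nonneg (((ModularGroup.T ^ (-round w.re) • w : ℍ) : ℂ).re)]
      · rw [hre, abs_le]
        push_cast
        constructor <;> linarith [hr.1, hr.2]
  have hblock : ∀ j : ℕ, ∫⁻ w in ⋃ i ∈ Finset.range h,
      (ModularGroup.T ^ (n₀ + h * j + i : ℤ)) • ModularGroup.fd, ENNReal.ofReal (pnorm k f w) ≤
      energy Γ k f := by
    intro j
    refine (lintegral_biUnion_finset_le _ _ _).trans ?_
    refine sum_setLIntegral_smul_fd_le (invariant_ofReal_pnorm hΓ) (Finset.range h)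
      (fun i ↦ ModularGroup.T ^ (n₀ + h * j + i : ℤ)) (fun i hi i' hi' hmem ↦ ?_)
    rw [← zpow_neg, ← zpow_add] at hmem
    have hdvd := hh _ hmem
    rw [Finset.mem_range] at hi hi'
    have : (n₀ + h * j + i + -(n₀ + h * j + i') : ℤ) = i - i' := by ring
    rw [this] at hdvd
    have := Int.eq_zero_of_abs_lt_dvd hdvd (by rw [abs_lt]; constructor <;> linarith)
    omega
  have hint : ∫⁻ w in disc k z, ENNReal.ofReal (pnorm k f w) ≤ m * energy Γ k f := by
    refine (setLIntegral_le_sum _ _ hcover _).trans ?_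
    refine (Finset.sum_le_sum fun j _ ↦ hblock j).trans ?_
    rw [Finset.sum_const, nsmul_eq_mul, Finset.card_range]
  have hmle : (m : ℝ) ≤ z.im / (h * √k) + 3 := by
    rw [hm]
    push_cast
    have h1 := Nat.floor_le (a := (2 * R + 2) / h) (by positivity)
    have h2 : (2 * R + 2) / h ≤ z.im / (h * √k) + 2 := by
      rw [add_div, hR]
      have : 2 * (z.im / (2 * √k)) / h = z.im / (h * √k) := by field_simp
      rw [this]
      gcongr
      exact div_le_self (by norm_num) hh0
    linarith
  calc _ ≤ ENNReal.ofReal (6 * k) * (m * energy Γ k f) := by gcongr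
    _ = ENNReal.ofReal (6 * k * m) * energy Γ k f := by
      rw [← mul_assoc, ← ENNReal.ofReal_natCast, ← ENNReal.ofReal_mul (by positivity)]
    _ ≤ _ := by gcongr

/-- Exponential decay of a periodic function vanishing at the cusp, with explicit constants. This is
the maximum principle for `F(q) / q`, where `f(z) = F(q)`. -/
lemma norm_le_mul_exp_of_periodic {f : ℍ → ℂ} {H : ℝ} (hH : 0 < H)
    (hper : Function.Periodic (f ∘ ofComplex) H) (hf : MDiff f) (hzero : IsZeroAtImInfty f)
    {Y V : ℝ} (hY : 0 < Y) (hV : ∀ w : ℍ, w.im = Y → ‖f w‖ ≤ V) {z : ℍ} (hz : Y ≤ z.im) :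
    ‖f z‖ ≤ V * Real.exp (-2 * Real.pi * (z.im - Y) / H) := by
  set F := cuspFunction H f
  have hF : DifferentiableOn ℂ F (Metric.ball 0 1) :=
    differentiableOn_cuspFunction_ball hH hper hf hzero.isBoundedAtImInfty
  have hF0 : F 0 = 0 := hzero.cuspFunction_apply_zero hH
  set r := Real.exp (-2 * Real.pi * Y / H) with hr
  have hr0 : 0 < r := Real.exp_pos _
  have hr1 : r < 1 := by
    rw [hr, Real.exp_lt_one_iff, neg_mul, neg_mul, neg_div]
    have := Real.pi_pos
    exact neg_neg_of_pos (by positivity)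
  have hD : DifferentiableOn ℂ (dslope F 0) (Metric.ball 0 1) :=
    (Complex.differentiableOn_dslope (Metric.ball_mem_nhds 0 one_pos)).mpr hF
  have hD' : DiffContOnCl ℂ (dslope F 0) (Metric.ball 0 r) :=
    hD.diffContOnCl_ball (Metric.closedBall_subset_ball hr1)
  have hval : ∀ q : ℂ, q ≠ 0 → ‖dslope F 0 q‖ = ‖F q‖ / ‖q‖ := by
    intro q hq
    rw [dslope_of_ne _ hq, slope_def_field, hF0, sub_zero, sub_zero, norm_div]
  have hfr : ∀ q ∈ frontier (Metric.ball (0 : ℂ) r), ‖dslope F 0 q‖ ≤ V / r := by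
    intro q hq
    rw [frontier_ball _ hr0.ne', mem_sphere_zero_iff_norm] at hq
    have hq0 : q ≠ 0 := by
      rintro rfl
      rw [norm_zero] at hq
      exact hr0.ne hq
    have him : (Function.Periodic.invQParam H q).im = Y := by
      rw [Function.Periodic.im_invQParam, hq, hr, Real.log_exp]
      have := Real.pi_ne_zero
      field_simp
    have h1 := eq_cuspFunction (f := f) ⟨Function.Periodic.invQParam H q, by rw [him]; exact hY⟩
      hH.ne' hper
    have h2 : F q = f ⟨Function.Periodic.invQParam H q, by rw [him]; exact hY⟩ := by
      rw [← h1]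
      congr 1
      exact (Function.Periodic.qParam_right_inv hH.ne' hq0).symm
    rw [hval q hq0, hq, h2]
    gcongr
    exact hV _ him
  set q := Function.Periodic.qParam H (z : ℂ)
  have hqn : ‖q‖ = Real.exp (-2 * Real.pi * z.im / H) := by
    rw [Function.Periodic.norm_qParam, coe_im]
  have hq0 : 0 < ‖q‖ := by rw [hqn]; exact Real.exp_pos _
  have hqr : q ∈ closure (Metric.ball (0 : ℂ) r) := by
    rw [closure_ball _ hr0.ne', mem_closedBall_zero_iff, hqn, hr]
    apply Real.exp_le_exp.mpr
    have := Real.pi_pos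
    gcongr ?_ / H
    nlinarith
  have hmax := Complex.norm_le_of_forall_mem_frontier_norm_le Metric.isBounded_ball hD' hfr hqr
  rw [hval q (norm_pos_iff.mp hq0), div_le_iff₀ hq0] at hmax
  have hfz : F q = f z := eq_cuspFunction z hH.ne' hper
  rw [hfz] at hmax
  refine hmax.trans_eq ?_
  rw [hqn, hr, div_mul_eq_mul_div, mul_div_assoc, ← Real.exp_sub]
  congr 2
  ring

lemma periodic_of_slash_T_zpow {k : ℤ} {f : ℍ → ℂ} {n : ℤ}
    (hf : f ∣[k] (ModularGroup.T ^ n) = f) :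
    Function.Periodic (f ∘ ofComplex) ((n : ℝ) : ℂ) := by
  have key : ∀ z : ℍ, f (ModularGroup.T ^ n • z) = f z := by
    intro z
    conv_rhs => rw [← hf]
    rw [ModularForm.SL_slash_apply, ModularGroup.denom_apply, ModularGroup.coe_T_zpow]
    simp
  intro w
  by_cases hw : 0 < w.im
  · have hw' : 0 < (w + ((n : ℝ) : ℂ)).im := by simpa using hw
    simp only [Function.comp_apply, ofComplex_apply_of_im_pos hw', ofComplex_apply_of_im_pos hw]
    conv_rhs => rw [← key]
    congr 1
    ext1
    rw [ModularGroup.coe_T_zpow_smul_eq]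
    simp
  · have hw' : ¬ 0 < (w + ((n : ℝ) : ℂ)).im := by simpa using hw
    simp only [Function.comp_apply]
    rw [ofComplex_apply_of_im_nonpos (not_lt.mp hw'), ofComplex_apply_of_im_nonpos (not_lt.mp hw)]

lemma T_zpow_two_mul_mem {Γ : Subgroup SL(2, ℤ)} {n : ℤ} (h : ModularGroup.T ^ n ∈ pm Γ) :
    ModularGroup.T ^ (2 * n) ∈ Γ := by
  have : (ModularGroup.T ^ n) ^ 2 = ModularGroup.T ^ (2 * n) := by
    rw [← zpow_natCast, ← zpow_mul, mul_comm]; rfl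
  rw [← this]
  rcases mem_pm.mp h with h | h
  · exact pow_mem h 2
  · rw [← neg_sq]; exact pow_mem h 2

/-- The width of the cusp `∞` for `{±1} Γ`. -/
lemma exists_width (Γ : Subgroup SL(2, ℤ)) [Γ.FiniteIndex] :
    ∃ h : ℕ, 0 < h ∧ ∀ m : ℤ, ModularGroup.T ^ m ∈ pm Γ ↔ (h : ℤ) ∣ m := by
  classical
  obtain ⟨n, hn0, -, hn⟩ := Subgroup.exists_pow_mem_of_index_ne_zero
    (Subgroup.FiniteIndex.index_ne_zero (H := pm Γ)) ModularGroup.T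
  have hex : ∃ n : ℕ, 0 < n ∧ ModularGroup.T ^ n ∈ pm Γ := ⟨n, hn0, hn⟩
  refine ⟨Nat.find hex, (Nat.find_spec hex).1, fun m ↦ ⟨fun hm ↦ ?_, ?_⟩⟩
  · have hpos : (0 : ℤ) < Nat.find hex := by exact_mod_cast (Nat.find_spec hex).1
    by_contra hdvd
    have hr0 := Int.emod_nonneg m hpos.ne'
    have hr1 := Int.emod_lt_of_pos m hpos
    have hr2 : m % (Nat.find hex : ℤ) ≠ 0 := fun h ↦ hdvd (Int.dvd_of_emod_eq_zero h)
    obtain ⟨r, hr⟩ := Int.eq_ofNat_of_zero_le hr0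
    have hmem : ModularGroup.T ^ r ∈ pm Γ := by
      have h1 : ModularGroup.T ^ (r : ℤ) =
          ModularGroup.T ^ m * ((ModularGroup.T ^ (Nat.find hex)) ^ (m / (Nat.find hex : ℤ)))⁻¹ := by
        rw [← zpow_natCast, ← zpow_mul, ← zpow_neg, ← zpow_add, ← hr, Int.emod_def]
        congr 1
      rw [← zpow_natCast, h1]
      exact mul_mem hm (inv_mem (zpow_mem (Nat.find_spec hex).2 _))
    exact Nat.find_min hex (m := r) (by omega) ⟨by omega, hmem⟩
  · rintro ⟨j, rfl⟩
    rw [zpow_mul, zpow_natCast]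
    exact zpow_mem (Nat.find_spec hex).2 _

lemma rpow_three_halves {k : ℝ} (hk : 0 ≤ k) : k ^ (3 / 2 : ℝ) = k * √k := by
  rw [Real.sqrt_eq_rpow, ← Real.rpow_one_add' hk (by norm_num)]
  norm_num

/-- A point of the standard fundamental domain. Above the height `k h`, where `h` is the width of
the cusp, the weighted absolute value decreases. -/
lemma exists_pnorm_le_of_mem_fd : ∃ C : ℝ, 0 < C ∧ ∀ (Γ : Subgroup SL(2, ℤ)) [Γ.FiniteIndex]
    (k : ℤ), 2 < k → ∀ f : ℍ → ℂ, MDiff f → (∀ γ ∈ Γ, f ∣[k] γ = f) → IsZeroAtImInfty f →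
    ∀ z ∈ ModularGroup.fd,
    ENNReal.ofReal (pnorm k f z) ≤ ENNReal.ofReal (C * (k : ℝ) ^ (3 / 2 : ℝ)) * energy Γ k f := by
  obtain ⟨C₀, hC₀, hlow⟩ := exists_pnorm_le_of_im_le_two
  refine ⟨C₀ + 24, by positivity, fun Γ _ k hk2 f hf hΓ hzero z hz ↦ ?_⟩
  have hk : 1 ≤ k := by omega
  have hk' : (1 : ℝ) ≤ k := by exact_mod_cast hk
  have hk2' : (2 : ℝ) < k := by exact_mod_cast hk2
  have hs : 1 ≤ √(k : ℝ) := Real.one_le_sqrt.mpr hk'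
  rw [rpow_three_halves (by linarith)]
  have hks : (k : ℝ) ≤ k * √k := le_mul_of_one_le_right (by linarith) hs
  rcases le_or_gt z.im 2 with hz2 | hz2
  · refine (hlow Γ k hk f hf hΓ z hz hz2).trans ?_
    gcongr
    nlinarith
  obtain ⟨h, h0, hh⟩ := exists_width Γ
  have hh0 : (1 : ℝ) ≤ h := by exact_mod_cast h0
  have hmid : ∀ w : ℍ, 2 ≤ w.im → w.im ≤ k * h →
      ENNReal.ofReal (pnorm k f w) ≤ ENNReal.ofReal (24 * (k * √k)) * energy Γ k f := by
    intro w hw hwk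
    refine (pnorm_le_of_two_le_im hk hf hΓ h0 (fun m hm ↦ (hh m).mp hm) hw).trans ?_
    refine mul_le_mul_left (ENNReal.ofReal_le_ofReal ?_) _
    have : w.im / (h * √k) ≤ √k := by
      rw [div_le_iff₀ (by positivity)]
      have := Real.mul_self_sqrt (show (0 : ℝ) ≤ k by linarith)
      nlinarith
    nlinarith
  have h24 : ENNReal.ofReal (24 * (k * √k)) * energy Γ k f ≤
      ENNReal.ofReal ((C₀ + 24) * (k * √k)) * energy Γ k f := by
    gcongr
    linarith
  refine le_trans ?_ h24
  rcases le_or_gt z.im (k * h) with hzk | hzk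
  · exact hmid z hz2.le hzk
  rcases eq_or_ne (energy Γ k f) ⊤ with he | he
  · rw [he, ENNReal.mul_top (by rw [ne_eq, ENNReal.ofReal_eq_zero, not_le]; positivity)]
    exact le_top
  set A := 24 * (k * √k) * (energy Γ k f).toReal with hA
  have hA0 : 0 ≤ A := by positivity
  have hAe : ENNReal.ofReal (24 * (k * √k)) * energy Γ k f = ENNReal.ofReal A := by
    rw [hA, ENNReal.ofReal_mul (q := (energy Γ k f).toReal) (by positivity),
      ENNReal.ofReal_toReal he]
  rw [hAe]
  apply ENNReal.ofReal_le_ofReal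
  set Y : ℝ := k * h with hYdef
  have hY2 : 2 ≤ Y := by nlinarith
  have hY0 : 0 < Y := by linarith
  have hYz : Y ≤ z.im := hzk.le
  have hYk : 0 < Y ^ k := zpow_pos hY0 k
  have hV : ∀ w : ℍ, w.im = Y → ‖f w‖ ≤ √(A / Y ^ k) := by
    intro w hw
    have hp := hmid w (by rw [hw]; exact hY2) hw.le
    rw [hAe, ENNReal.ofReal_le_ofReal_iff hA0] at hp
    apply Real.le_sqrt_of_sq_le
    rw [le_div_iff₀ hYk, mul_comm, ← hw]
    exact hp
  have hT : ModularGroup.T ^ (2 * (h : ℤ)) ∈ Γ := T_zpow_two_mul_mem ((hh h).mpr dvd_rfl)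
  have hper := periodic_of_slash_T_zpow (hΓ _ hT)
  have hfz := norm_le_mul_exp_of_periodic (H := ((2 * (h : ℤ) : ℤ) : ℝ)) (by positivity) hper hf
    hzero hY0 hV hYz
  have hz0 := z.im_pos
  have hpi := Real.pi_gt_three
  set t := (z.im - Y) / Y with ht
  have ht0 : 0 ≤ t := div_nonneg (by linarith) hY0.le
  have hzY : z.im = Y * (1 + t) := by rw [ht]; field_simp; ring
  have h1 : (1 + t) ^ k ≤ Real.exp (k * t) := by
    rw [← Real.rpow_intCast, mul_comm, Real.exp_mul]
    have := Real.add_one_le_exp t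
    gcongr
    linarith
  have h2 : Real.exp (-2 * Real.pi * (z.im - Y) / ((2 * (h : ℤ) : ℤ) : ℝ)) ^ 2 ≤
      Real.exp (-(k * t)) := by
    rw [← Real.exp_nat_mul]
    apply Real.exp_le_exp.mpr
    have h3 : z.im - Y = Y * t := by rw [hzY]; ring
    have h4 : (k : ℝ) ≤ Y / h := by
      rw [le_div_iff₀ (by positivity)]
    have h5 : ((2 : ℕ) : ℝ) * (-2 * Real.pi * (z.im - Y) / ((2 * (h : ℤ) : ℤ) : ℝ)) =
        -(2 * Real.pi * (Y / h) * t) := by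
      rw [h3]; push_cast; field_simp
    rw [h5, neg_le_neg_iff]
    gcongr
    have : 0 ≤ Y / h := by positivity
    nlinarith
  calc pnorm k f z = z.im ^ k * ‖f z‖ ^ 2 := rfl
    _ ≤ z.im ^ k * (√(A / Y ^ k) *
        Real.exp (-2 * Real.pi * (z.im - Y) / ((2 * (h : ℤ) : ℤ) : ℝ))) ^ 2 := by
        gcongr
    _ = A * (1 + t) ^ k *
        Real.exp (-2 * Real.pi * (z.im - Y) / ((2 * (h : ℤ) : ℤ) : ℝ)) ^ 2 := by
        rw [mul_pow, Real.sq_sqrt (by positivity)]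
        conv_lhs => rw [hzY]
        rw [mul_zpow, ← hzY]
        field_simp
    _ ≤ A * Real.exp (k * t) * Real.exp (-(k * t)) := by gcongr
    _ = A := by rw [mul_assoc, ← Real.exp_add, add_neg_cancel, Real.exp_zero, mul_one]

section Forms

variable {Γ : Subgroup SL(2, ℤ)} {k : ℤ}

lemma slash_eq (F : S Γ k) {γ : SL(2, ℤ)} (hγ : γ ∈ Γ) : (F : ℍ → ℂ) ∣[k] γ = F :=
  SlashInvariantFormClass.slash_action_eq F _ (Subgroup.mem_map_of_mem _ hγ)

lemma slash_conj {f : ℍ → ℂ} (hf : ∀ γ ∈ Γ, f ∣[k] γ = f) (σ : SL(2, ℤ)) :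
    ∀ γ ∈ conj σ Γ, (f ∣[k] σ) ∣[k] γ = f ∣[k] σ := by
  intro γ hγ
  have h := hf _ (mem_conj.mp hγ)
  rw [← SlashAction.slash_mul]
  conv_rhs => rw [← h]
  rw [← SlashAction.slash_mul]
  congr 1
  group

lemma mdifferentiable_slash {f : ℍ → ℂ} (hf : MDiff f) (k : ℤ) (σ : SL(2, ℤ)) :
    MDiff (f ∣[k] σ) := by
  rw [ModularForm.SL_slash]
  exact hf.slash k _

/-- The energy is transported by the slash action. -/
lemma energy_conj [Γ.FiniteIndex] {f : ℍ → ℂ} (hf : ∀ γ ∈ Γ, f ∣[k] γ = f) (σ : SL(2, ℤ)) :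
    energy (conj σ Γ) k (f ∣[k] σ) = energy Γ k f := by
  unfold energy
  simp_rw [pnorm_slash]
  exact lintegral_fundDomain_conj (invariant_ofReal_pnorm hf) σ

end Forms

/-- The upper bound for a single cusp form, with an absolute constant. -/
lemma exists_pnorm_le : ∃ C : ℝ, 0 < C ∧ ∀ (Γ : Subgroup SL(2, ℤ)) [Γ.FiniteIndex]
    (k : ℤ), 2 < k → ∀ (F : S Γ k) (z : ℍ),
    ENNReal.ofReal (pnorm k F z) ≤ ENNReal.ofReal (C * (k : ℝ) ^ (3 / 2 : ℝ)) * energy Γ k F := by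
  obtain ⟨C, hC, h⟩ := exists_pnorm_le_of_mem_fd
  refine ⟨C, hC, fun Γ _ k hk F z ↦ ?_⟩
  obtain ⟨g, hg⟩ := ModularGroup.exists_smul_mem_fd z
  have hinv : ∀ γ ∈ Γ, (F : ℍ → ℂ) ∣[k] γ = F := fun γ hγ ↦ slash_eq F hγ
  have := h (conj g⁻¹ Γ) k hk ((F : ℍ → ℂ) ∣[k] g⁻¹)
    (mdifferentiable_slash (CuspFormClass.holo F) k _) (slash_conj hinv _)
    (CuspFormClass.zero_at_infty_slash F _) (g • z) hg
  rwa [pnorm_slash, inv_smul_smul, energy_conj hinv] at this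

/-! ### The volume of the fundamental domain -/

/-- The integral over the standard fundamental domain of a function of the height. -/
lemma setLIntegral_fd_le {u : ℝ → ℝ≥0∞} (hu : Measurable u) :
    ∫⁻ z in ModularGroup.fd, u z.im ≤
      ∫⁻ y in Set.Ioi (1 / 2 : ℝ), ENNReal.ofReal (1 / y ^ 2) * u y := by
  have h := setLIntegral_coe measurableSet_fd (fun ζ ↦ u ζ.im)
  simp only [coe_im] at h
  rw [h]
  have hsub : ((↑) '' ModularGroup.fd : Set ℂ) ⊆ Complex.measurableEquivRealProd ⁻¹'
      (Set.Icc (-(1 / 2)) (1 / 2) ×ˢ Set.Ioi (1 / 2 : ℝ)) := by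
    rintro _ ⟨z, hz, rfl⟩
    have h1 := ModularGroup.three_le_four_mul_im_sq_of_mem_fd hz
    have h2 := z.im_pos
    refine ⟨abs_le.mp hz.2, ?_⟩
    change 1 / 2 < z.im
    nlinarith
  refine (lintegral_mono_set hsub).trans ?_
  have hprod := Complex.volume_preserving_equiv_real_prod.setLIntegral_comp_preimage_emb
    Complex.measurableEquivRealProd.measurableEmbedding
    (fun p : ℝ × ℝ ↦ ENNReal.ofReal (1 / p.2 ^ 2) * u p.2)
    (Set.Icc (-(1 / 2)) (1 / 2) ×ˢ Set.Ioi (1 / 2 : ℝ))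
  refine hprod.le.trans ?_
  have hm : Measurable fun p : ℝ × ℝ ↦ ENNReal.ofReal (1 / p.2 ^ 2) * u p.2 := by fun_prop
  rw [Measure.volume_eq_prod, setLIntegral_prod _ hm.aemeasurable]
  dsimp only
  rw [lintegral_const, Measure.restrict_apply_univ, Real.volume_Icc]
  norm_num

lemma lintegral_Ioi_rpow {p a : ℝ} (hp : 1 < p) (ha : 0 < a) :
    ∫⁻ y in Set.Ioi a, ENNReal.ofReal (y ^ (-p)) = ENNReal.ofReal (a ^ (1 - p) / (p - 1)) := by
  rw [← ofReal_integral_eq_lintegral_ofReal (integrableOn_Ioi_rpow_of_lt (by linarith) ha),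
    integral_Ioi_rpow_of_lt (by linarith) ha]
  · congr 1
    rw [show -p + 1 = -(p - 1) by ring, neg_div_neg_eq, show -(p - 1) = 1 - p by ring]
  · filter_upwards [ae_restrict_mem measurableSet_Ioi] with y hy
    exact Real.rpow_nonneg (ha.trans hy).le _

lemma volume_fd_le : volume ModularGroup.fd ≤ 2 := by
  have h := setLIntegral_fd_le (u := fun _ ↦ 1) measurable_const
  rw [setLIntegral_one] at h
  refine h.trans ?_
  have h2 := lintegral_Ioi_rpow (p := 2) (a := 1 / 2) (by norm_num) (by norm_num)
  calc _ = ∫⁻ y in Set.Ioi (1 / 2 : ℝ), ENNReal.ofReal (y ^ (-2 : ℝ)) := by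
        refine setLIntegral_congr_fun measurableSet_Ioi fun y hy ↦ ?_
        have : (0 : ℝ) < y := by have : 1 / 2 < y := hy; linarith
        simp only [mul_one]
        rw [Real.rpow_neg this.le]
        norm_num
    _ ≤ 2 := by
      rw [h2]
      norm_num [Real.rpow_neg]

lemma volume_fundDomain_le (Γ : Subgroup SL(2, ℤ)) [Γ.FiniteIndex] :
    volume (fundDomain Γ) ≤ ENNReal.ofReal (2 * Γ.index) := by
  have h := lintegral_fundDomain Γ (fun _ ↦ 1)
  rw [setLIntegral_one] at h
  have hc : ∀ q, cosetIntegral Γ (fun _ ↦ 1) q ≤ 2 := fun q ↦ by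
    rw [cosetIntegral, setLIntegral_one]
    exact volume_fd_le
  rw [h]
  have := Fintype.ofFinite (SL(2, ℤ) ⧸ pm Γ)
  rw [tsum_fintype]
  refine (Finset.sum_le_sum fun q _ ↦ hc q).trans ?_
  rw [Finset.sum_const, Finset.card_univ, nsmul_eq_mul, ← Nat.card_eq_fintype_card,
    ← Subgroup.index, mul_comm 2, ENNReal.ofReal_mul (by positivity), ENNReal.ofReal_natCast]
  have hidx : (pm Γ).index ≤ Γ.index :=
    Subgroup.index_antitone le_sup_left
  gcongr
  norm_num

/-! ### The Petersson inner product -/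

section Inner

variable {Γ : Subgroup SL(2, ℤ)} [Γ.FiniteIndex] {k : ℤ}

lemma integrableOn_petersson (F G : S Γ k) :
    IntegrableOn (petersson k F G) (fundDomain Γ) := by
  obtain ⟨C, hC⟩ := CuspFormClass.petersson_bounded_left k (Γ.map (mapGL ℝ)) F G
  have hfin : volume (fundDomain Γ) < ⊤ := (volume_fundDomain_le Γ).trans_lt ENNReal.ofReal_lt_top
  have hcont : Continuous (petersson k F G) :=
    petersson_continuous k (CuspFormClass.holo F).continuous (CuspFormClass.holo G).continuous
  exact Measure.integrableOn_of_bounded hfin.ne hcont.aestronglyMeasurable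
    (Eventually.of_forall hC)

lemma peterssonInner_self (F : S Γ k) :
    peterssonInner Γ k F F = ((energy Γ k F).toReal : ℂ) ∧ energy Γ k F ≠ ⊤ := by
  have hi := integrableOn_petersson F F
  have hp : ∀ z, petersson k F F z = (pnorm k F z : ℂ) := petersson_self k F
  have hi' : IntegrableOn (pnorm k F) (fundDomain Γ) := by
    exact (hi.re : Integrable _ _).congr (Eventually.of_forall fun z ↦ by simp [hp])
  have he : energy Γ k F = ENNReal.ofReal (∫ z in fundDomain Γ, pnorm k F z) := by
    rw [energy, ofReal_integral_eq_lintegral_ofReal hi'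
      (Eventually.of_forall fun z ↦ pnorm_nonneg k F z)]
  constructor
  · rw [he, ENNReal.toReal_ofReal (integral_nonneg fun z ↦ pnorm_nonneg k F z), peterssonInner]
    simp_rw [hp]
    exact integral_ofReal
  · rw [he]; exact ENNReal.ofReal_ne_top

lemma eq_zero_of_energy_eq_zero (hk : 2 < k) {F : S Γ k} (h : energy Γ k F = 0) : F = 0 := by
  obtain ⟨C, hC, hup⟩ := exists_pnorm_le
  ext z
  have := hup Γ k hk F z
  rw [h, mul_zero, nonpos_iff_eq_zero, ENNReal.ofReal_eq_zero] at this
  have h0 := this.antisymm (pnorm_nonneg k F z)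
  have hy : z.im ^ k ≠ 0 := (zpow_pos z.im_pos k).ne'
  simpa [pnorm, hy] using h0

variable (Γ k) in
/-- The Petersson inner product as an inner product on `S_k(Γ)`, conjugate linear in the first
variable. -/
@[reducible] def innerCore (hk : 2 < k) : InnerProductSpace.Core ℂ (S Γ k) where
  inner F G := peterssonInner Γ k G F
  conj_inner_symm F G := by
    simp only [peterssonInner]
    rw [← integral_conj]
    exact integral_congr_ae (Eventually.of_forall fun z ↦ (petersson_symm k G F z).symm)
  re_inner_nonneg F := by
    rw [(peterssonInner_self F).1]
    exact ENNReal.toReal_nonneg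
  add_left F G H := by
    simp only [peterssonInner]
    rw [← integral_add (integrableOn_petersson F H) (integrableOn_petersson G H)]
    refine integral_congr_ae (Eventually.of_forall fun z ↦ ?_)
    simp [petersson, add_mul]
  smul_left F G a := by
    simp only [peterssonInner]
    rw [← integral_const_mul]
    refine integral_congr_ae (Eventually.of_forall fun z ↦ ?_)
    simp [petersson, mul_assoc]
  definite F hF := by
    change peterssonInner Γ k F F = 0 at hF
    have h := peterssonInner_self F
    rw [h.1, Complex.ofReal_eq_zero, ENNReal.toReal_eq_zero_iff, or_iff_left h.2] at hF
    exact eq_zero_of_energy_eq_zero hk hF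

end Inner

/-! ### Orthonormal families of cusp forms -/

section Orthonormal

variable {Γ : Subgroup SL(2, ℤ)} {k : ℤ} {ι : Type*} [Fintype ι]

lemma sum_smul_apply (a : ι → ℂ) (v : ι → S Γ k) (z : ℍ) :
    (∑ i, a i • v i : S Γ k) z = ∑ i, a i * v i z := by
  let e : S Γ k →+ ℂ := ⟨⟨fun F ↦ F z, rfl⟩, fun _ _ ↦ rfl⟩
  exact map_sum e (fun i ↦ a i • v i) Finset.univ

variable [DecidableEq ι] [Γ.FiniteIndex]

lemma energy_sum_smul (hk : 2 < k) {v : ι → S Γ k}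
    (hv : ∀ i j, peterssonInner Γ k (v i) (v j) = if i = j then 1 else 0) (a : ι → ℂ) :
    energy Γ k (∑ i, a i • v i : S Γ k) = ENNReal.ofReal (∑ i, ‖a i‖ ^ 2) := by
  let : NormedAddCommGroup (S Γ k) := (innerCore Γ k hk).toNormedAddCommGroup
  let : InnerProductSpace ℂ (S Γ k) := InnerProductSpace.ofCore (innerCore Γ k hk).toCore
  have hon : Orthonormal ℂ v := orthonormal_iff_ite.mpr fun i j ↦ by
    change peterssonInner Γ k (v j) (v i) = _
    rw [hv]
    simp only [eq_comm]
  have h := hon.inner_sum a a Finset.univ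
  obtain ⟨h1, h2⟩ := peterssonInner_self (∑ i, a i • v i : S Γ k)
  change peterssonInner Γ k (∑ i, a i • v i) (∑ i, a i • v i) = _ at h
  rw [h1] at h
  rw [← ENNReal.ofReal_toReal h2]
  congr 1
  have h3 : ∀ i, (starRingEnd ℂ) (a i) * a i = ((‖a i‖ ^ 2 : ℝ) : ℂ) := fun i ↦ by
    rw [Complex.conj_mul']; push_cast; rfl
  simp_rw [h3] at h
  exact_mod_cast h

end Orthonormal

/-- The upper bound for orthonormal families: the bound for a single form, applied to the form
`∑ i, conj (v i z) • v i` which is extremal at `z`. -/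
lemma exists_sum_pnorm_le : ∃ C : ℝ, 0 < C ∧ ∀ (Γ : Subgroup SL(2, ℤ)) [Γ.FiniteIndex]
    (k : ℤ), 2 < k → ∀ (n : ℕ) (v : Fin n → S Γ k),
    (∀ i j, peterssonInner Γ k (v i) (v j) = if i = j then 1 else 0) → ∀ z,
    ∑ i, pnorm k (v i) z ≤ C * (k : ℝ) ^ (3 / 2 : ℝ) := by
  obtain ⟨C, hC, hup⟩ := exists_pnorm_le
  refine ⟨C, hC, fun Γ _ k hk n v hv z ↦ ?_⟩
  have hk0 : (0 : ℝ) ≤ k := by exact_mod_cast (by lia : (0 : ℤ) ≤ k)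
  set a : Fin n → ℂ := fun i ↦ starRingEnd ℂ (v i z) with ha
  set t : ℝ := ∑ i, ‖v i z‖ ^ 2 with ht
  have ht0 : 0 ≤ t := by positivity
  have h := hup Γ k hk (∑ i, a i • v i) z
  have hval : (∑ i, a i • v i : S Γ k) z = (t : ℂ) := by
    rw [sum_smul_apply, ht]
    push_cast
    exact Finset.sum_congr rfl fun i _ ↦ Complex.conj_mul' _
  rw [energy_sum_smul hk hv, ← ENNReal.ofReal_mul (by positivity),
    ENNReal.ofReal_le_ofReal_iff (by positivity), pnorm, hval] at h
  simp only [ha, RCLike.norm_conj, Complex.norm_real, Real.norm_of_nonneg ht0] at h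
  rw [← ht] at h
  have hsum : ∑ i, pnorm k (v i) z = z.im ^ k * t := by
    simp only [pnorm, ht, Finset.mul_sum]
  rw [hsum]
  rcases ht0.eq_or_lt with h0 | h0
  · rw [← h0, mul_zero]; positivity
  · refine le_of_mul_le_mul_right ?_ h0
    calc _ = z.im ^ k * t ^ 2 := by ring
      _ ≤ _ := h

lemma finiteDimensional (Γ : Subgroup SL(2, ℤ)) [Γ.FiniteIndex] {k : ℤ} (hk : 2 < k) :
    FiniteDimensional ℂ (S Γ k) := by
  obtain ⟨C, hC, hup⟩ := exists_sum_pnorm_le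
  have hk0 : (0 : ℝ) ≤ k := by exact_mod_cast (by lia : (0 : ℤ) ≤ k)
  let : NormedAddCommGroup (S Γ k) := (innerCore Γ k hk).toNormedAddCommGroup
  let : InnerProductSpace ℂ (S Γ k) := InnerProductSpace.ofCore (innerCore Γ k hk).toCore
  -- Integrating the bound for an orthonormal family bounds its cardinality by the volume.
  have hcard : ∀ (n : ℕ) (v : Fin n → S Γ k), Orthonormal ℂ v →
      n ≤ ⌊C * (k : ℝ) ^ (3 / 2 : ℝ) * (2 * Γ.index)⌋₊ := by
    intro n v hon
    have hv : ∀ i j, peterssonInner Γ k (v i) (v j) = if i = j then 1 else 0 := fun i j ↦ by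
      exact (orthonormal_iff_ite.mp hon j i).trans (if_congr eq_comm rfl rfl)
    have he : ∀ i, energy Γ k (v i) = 1 := fun i ↦ by
      obtain ⟨h1, h2⟩ := peterssonInner_self (v i)
      rw [hv, if_pos rfl] at h1
      rw [← ENNReal.ofReal_toReal h2, ← (by exact_mod_cast h1 : 1 = (energy Γ k (v i)).toReal),
        ENNReal.ofReal_one]
    have hmeas : ∀ i, Measurable fun z ↦ ENNReal.ofReal (pnorm k (v i) z) := fun i ↦ by
      have : Continuous (v i) := (CuspFormClass.holo (v i)).continuous
      have : Continuous fun z : ℍ ↦ z.im ^ k :=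
        continuous_iff_continuousAt.mpr fun z ↦
          (UpperHalfPlane.continuous_im.continuousAt).zpow₀ k (Or.inl z.im_pos.ne')
      unfold pnorm
      fun_prop
    have hle : (n : ℝ≥0∞) ≤ ENNReal.ofReal (C * (k : ℝ) ^ (3 / 2 : ℝ) * (2 * Γ.index)) := by
      calc (n : ℝ≥0∞) = ∑ i, energy Γ k (v i) := by simp [he]
        _ = ∫⁻ z in fundDomain Γ, ∑ i, ENNReal.ofReal (pnorm k (v i) z) := by
          rw [lintegral_finsetSum _ fun i _ ↦ hmeas i]; rfl
        _ ≤ ∫⁻ z in fundDomain Γ, ENNReal.ofReal (C * (k : ℝ) ^ (3 / 2 : ℝ)) := by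
          refine lintegral_mono fun z ↦ ?_
          rw [← ENNReal.ofReal_sum_of_nonneg fun i _ ↦ pnorm_nonneg _ _ _]
          exact ENNReal.ofReal_le_ofReal (hup Γ k hk n v hv z)
        _ ≤ _ := by
          rw [setLIntegral_const,
            ENNReal.ofReal_mul (p := C * (k : ℝ) ^ (3 / 2 : ℝ)) (by positivity)]
          exact mul_le_mul_right (volume_fundDomain_le Γ) _
    rw [← ENNReal.ofReal_natCast, ENNReal.ofReal_le_ofReal_iff (by positivity)] at hle
    exact Nat.le_floor hle
  refine Module.rank_lt_aleph0_iff.mp ((rank_le fun s hs ↦ ?_).trans_lt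
    (Cardinal.natCast_lt_aleph0 (n := ⌊C * (k : ℝ) ^ (3 / 2 : ℝ) * (2 * Γ.index)⌋₊)))
  have hlin := hs.comp _ s.equivFin.symm.injective
  exact hcard _ _ (InnerProductSpace.gramSchmidtNormed_orthonormal hlin)

lemma exists_isPeterssonOrthonormal (Γ : Subgroup SL(2, ℤ)) [Γ.FiniteIndex] {k : ℤ}
    (hk : 2 < k) :
    ∃ (n : ℕ) (B : Module.Basis (Fin n) ℂ (S Γ k)), IsPeterssonOrthonormal B := by
  have hfin := finiteDimensional Γ hk
  let : NormedAddCommGroup (S Γ k) := (innerCore Γ k hk).toNormedAddCommGroup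
  let : InnerProductSpace ℂ (S Γ k) := InnerProductSpace.ofCore (innerCore Γ k hk).toCore
  have : FiniteDimensional ℂ (S Γ k) := hfin
  refine ⟨_, (stdOrthonormalBasis ℂ (S Γ k)).toBasis, fun i j ↦ ?_⟩
  have h := orthonormal_iff_ite.mp (stdOrthonormalBasis ℂ (S Γ k)).orthonormal j i
  rw [OrthonormalBasis.coe_toBasis]
  exact h.trans (if_congr eq_comm rfl rfl)

/-- The Bergman kernel dominates every single form, by the Cauchy–Schwarz inequality. -/
lemma pnorm_le_energy_mul_bergman {Γ : Subgroup SL(2, ℤ)} [Γ.FiniteIndex] {k : ℤ} (hk : 2 < k)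
    {n : ℕ} {B : Module.Basis (Fin n) ℂ (S Γ k)} (hB : IsPeterssonOrthonormal B)
    (F : S Γ k) (z : ℍ) :
    ENNReal.ofReal (pnorm k F z) ≤ energy Γ k F * ENNReal.ofReal (bergman B z) := by
  set a : Fin n → ℂ := fun i ↦ B.repr F i
  have hF : F = ∑ i, a i • B i := (B.sum_repr F).symm
  have hFz : F z = ∑ i, a i * B i z := by rw [← sum_smul_apply, ← hF]
  have hE : energy Γ k F = ENNReal.ofReal (∑ i, ‖a i‖ ^ 2) := by
    rw [← energy_sum_smul hk hB, ← hF]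
  rw [hE, ← ENNReal.ofReal_mul (by positivity)]
  refine ENNReal.ofReal_le_ofReal ?_
  have hy : 0 ≤ z.im ^ k := (zpow_pos z.im_pos k).le
  have h1 : ‖F z‖ ≤ ∑ i, ‖a i‖ * ‖B i z‖ := by
    rw [hFz]
    exact (norm_sum_le _ _).trans_eq (by simp only [norm_mul])
  calc pnorm k F z = z.im ^ k * ‖F z‖ ^ 2 := rfl
    _ ≤ z.im ^ k * ((∑ i, ‖a i‖ ^ 2) * ∑ i, ‖B i z‖ ^ 2) := by
      gcongr
      exact (pow_le_pow_left₀ (norm_nonneg _) h1 2).trans (Finset.sum_mul_sq_le_sq_mul_sq _ _ _)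
    _ = (∑ i, ‖a i‖ ^ 2) * bergman B z := by
      rw [bergman, ← Finset.mul_sum]; ring

/-! ### Sums over rows -/

lemma tsum_nat_inv_sq_add_sq_le {Y : ℝ} (hY : 1 / 2 ≤ Y) :
    ∑' n : ℕ, ENNReal.ofReal (1 / ((n : ℝ) ^ 2 + Y ^ 2)) ≤ ENNReal.ofReal (6 / Y) := by
  have hY0 : 0 < Y := by linarith
  refine ENNReal.tsum_le_of_sum_range_le fun N ↦ ?_
  rw [← ENNReal.ofReal_sum_of_nonneg fun i _ ↦ by positivity]
  refine ENNReal.ofReal_le_ofReal ?_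
  -- The sum telescopes after comparison with `6 / (n + Y) - 6 / (n + 1 + Y)`.
  have hterm : ∀ n ∈ Finset.range N, 1 / ((n : ℝ) ^ 2 + Y ^ 2) ≤
      6 / ((n : ℝ) + Y) - 6 / (((n + 1 : ℕ) : ℝ) + Y) := by
    intro n _
    have hn : (0 : ℝ) ≤ n := n.cast_nonneg
    push_cast
    rw [div_sub_div _ _ (by positivity) (by positivity), div_le_div_iff₀ (by positivity)
      (by positivity)]
    nlinarith [sq_nonneg ((n : ℝ) - Y), mul_nonneg hn hY0.le]
  calc _ ≤ ∑ n ∈ Finset.range N, (6 / ((n : ℝ) + Y) - 6 / (((n + 1 : ℕ) : ℝ) + Y)) :=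
        Finset.sum_le_sum hterm
    _ = 6 / (((0 : ℕ) : ℝ) + Y) - 6 / ((N : ℝ) + Y) :=
        Finset.sum_range_sub' (fun n : ℕ ↦ 6 / ((n : ℝ) + Y)) N
    _ ≤ 6 / Y := by
        have : 0 ≤ 6 / ((N : ℝ) + Y) := by positivity
        simp only [Nat.cast_zero, zero_add]
        linarith

lemma tsum_int_inv_sq_add_sq_le (t : ℝ) {Y : ℝ} (hY : 1 / 2 ≤ Y) :
    ∑' d : ℤ, ENNReal.ofReal (1 / (((d : ℝ) + t) ^ 2 + Y ^ 2)) ≤ ENNReal.ofReal (12 / Y) := by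
  have hY0 : 0 < Y := by linarith
  have hpos : ∀ x : ℝ, 0 < x ^ 2 + Y ^ 2 := fun x ↦ by positivity
  -- Shift `d` so as to replace `t` by its fractional part.
  rw [← (Equiv.subRight ⌊t⌋).tsum_eq (fun d : ℤ ↦
    ENNReal.ofReal (1 / (((d : ℝ) + t) ^ 2 + Y ^ 2)))]
  have hfr : ∀ d : ℤ, (((Equiv.subRight ⌊t⌋ d : ℤ) : ℝ) + t) = d + Int.fract t := fun d ↦ by
    rw [Equiv.subRight_apply, Int.fract]; push_cast; ring
  simp_rw [hfr]
  have h0 := Int.fract_nonneg t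
  have h1 := (Int.fract_lt_one t).le
  set s := Int.fract t
  rw [tsum_of_nat_of_neg_add_one (f := fun d : ℤ ↦
    ENNReal.ofReal (1 / (((d : ℝ) + s) ^ 2 + Y ^ 2))) ENNReal.summable ENNReal.summable]
  have hsum := tsum_nat_inv_sq_add_sq_le hY
  calc _ ≤ ENNReal.ofReal (6 / Y) + ENNReal.ofReal (6 / Y) := by
        refine add_le_add ((ENNReal.tsum_le_tsum fun n ↦ ENNReal.ofReal_le_ofReal ?_).trans hsum)
          ((ENNReal.tsum_le_tsum fun n ↦ ENNReal.ofReal_le_ofReal ?_).trans hsum)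
        all_goals
          refine one_div_le_one_div_of_le (hpos _) ?_
          have hn : (0 : ℝ) ≤ n := n.cast_nonneg
          push_cast
          nlinarith
    _ = _ := by
        rw [← ENNReal.ofReal_add (by positivity) (by positivity)]
        congr 1; ring

lemma normSq_linear (c d : ℝ) (z : ℍ) :
    ‖(c * z + d : ℂ)‖ ^ 2 = (d + c * z.re) ^ 2 + (|c| * z.im) ^ 2 := by
  rw [← Complex.normSq_eq_norm_sq, Complex.normSq_apply, mul_pow, sq_abs]
  simp
  ring

lemma tsum_norm_linear_zpow_le {k : ℤ} (hk : 2 < k) {z : ℍ} (hz : 1 / 2 ≤ z.im) {c : ℤ}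
    (hc : c ≠ 0) :
    ∑' d : ℤ, ENNReal.ofReal (‖(c * z + d : ℂ)‖ ^ (-k)) ≤
      ENNReal.ofReal (12 * z.im ^ (1 - k) * (1 / (c : ℝ) ^ 2)) := by
  have hy := z.im_pos
  have hc1 : (1 : ℝ) ≤ |(c : ℝ)| := by exact_mod_cast Int.one_le_abs hc
  set Y : ℝ := |(c : ℝ)| * z.im with hYdef
  have hY : 1 / 2 ≤ Y := by nlinarith
  have hY0 : 0 < Y := by linarith
  have hterm : ∀ d : ℤ, ‖(c * z + d : ℂ)‖ ^ (-k) ≤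
      Y ^ (2 - k) * (1 / (((d : ℝ) + c * z.re) ^ 2 + Y ^ 2)) := by
    intro d
    have hsq := normSq_linear c d z
    push_cast at hsq
    rw [← hYdef] at hsq
    rw [← hsq]
    set N := ‖(c * z + d : ℂ)‖
    have hYN : Y ≤ N := by
      refine le_of_sq_le_sq ?_ (norm_nonneg _)
      rw [hsq]; nlinarith [sq_nonneg ((d : ℝ) + c * z.re)]
    have hN : 0 < N := hY0.trans_le hYN
    have h1 : N ^ (2 - k) ≤ Y ^ (2 - k) := by
      rw [show 2 - k = -(k - 2) by ring, zpow_neg, zpow_neg]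
      exact inv_anti₀ (zpow_pos hY0 _) (zpow_le_zpow_left₀ (by lia) hY0.le hYN)
    calc N ^ (-k) = N ^ (2 - k) * (1 / N ^ 2) := by
          rw [show -k = (2 - k) - 2 by ring, zpow_sub₀ hN.ne', div_eq_mul_one_div]; norm_cast
      _ ≤ _ := by gcongr
  calc _ ≤ ∑' d : ℤ, ENNReal.ofReal (Y ^ (2 - k)) *
        ENNReal.ofReal (1 / (((d : ℝ) + c * z.re) ^ 2 + Y ^ 2)) := by
        refine ENNReal.tsum_le_tsum fun d ↦ ?_
        rw [← ENNReal.ofReal_mul (by positivity)]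
        exact ENNReal.ofReal_le_ofReal (hterm d)
    _ ≤ ENNReal.ofReal (Y ^ (2 - k)) * ENNReal.ofReal (12 / Y) := by
        rw [ENNReal.tsum_mul_left]
        exact mul_le_mul_right (tsum_int_inv_sq_add_sq_le _ hY) _
    _ ≤ _ := by
        rw [← ENNReal.ofReal_mul (by positivity)]
        refine ENNReal.ofReal_le_ofReal ?_
        have h2 : |(c : ℝ)| ^ (1 - k) ≤ 1 / (c : ℝ) ^ 2 := by
          rw [← sq_abs (c : ℝ), one_div, ← zpow_natCast, ← zpow_neg]
          exact zpow_le_zpow_right₀ hc1 (by push_cast; lia)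
        calc Y ^ (2 - k) * (12 / Y) = 12 * Y ^ (1 - k) := by
              rw [show 1 - k = (2 - k) - 1 by ring, zpow_sub_one₀ hY0.ne']; ring
          _ = 12 * z.im ^ (1 - k) * |(c : ℝ)| ^ (1 - k) := by rw [hYdef, mul_zpow]; ring
          _ ≤ _ := by gcongr

/-- The linear form `u₀ z + u₁`. -/
def rowForm (u : Fin 2 → ℤ) (z : ℍ) : ℂ := u 0 * z + u 1

lemma denom_eq_rowForm (g : SL(2, ℤ)) (z : ℍ) : denom g z = rowForm (g.1 1) z :=
  ModularGroup.denom_apply g z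

/-- The sum of `|u₀ z + u₁| ^ (-k)` over the integral rows with `u₀ ≠ 0`. The bound is uniform in
the real part of `z`. -/
lemma exists_tsum_rowForm_le : ∃ C : ℝ, 0 < C ∧ ∀ k : ℤ, 2 < k → ∀ z : ℍ, 1 / 2 ≤ z.im →
    ∑' u : Fin 2 → ℤ, (if u 0 = 0 then 0 else ENNReal.ofReal (‖rowForm u z‖ ^ (-k))) ≤
      ENNReal.ofReal (C * z.im ^ (1 - k)) := by
  have hs : Summable fun c : ℤ ↦ 1 / (c : ℝ) ^ 2 :=
    Real.summable_one_div_int_pow.mpr one_lt_two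
  refine ⟨12 * (1 + ∑' c : ℤ, 1 / (c : ℝ) ^ 2), ?_, fun k hk z hz ↦ ?_⟩
  · have : 0 ≤ ∑' c : ℤ, 1 / (c : ℝ) ^ 2 := tsum_nonneg fun c ↦ by positivity
    positivity
  have hy := z.im_pos
  have hyk : 0 < z.im ^ (1 - k) := zpow_pos hy _
  rw [← (finTwoArrowEquiv ℤ).symm.tsum_eq, ENNReal.tsum_prod']
  calc _ ≤ ∑' c : ℤ, ENNReal.ofReal (12 * z.im ^ (1 - k) * (1 / (c : ℝ) ^ 2)) := by
        refine ENNReal.tsum_le_tsum fun c ↦ ?_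
        by_cases hc : c = 0
        · simp [finTwoArrowEquiv, hc]
        · simpa [finTwoArrowEquiv, hc, rowForm] using tsum_norm_linear_zpow_le hk hz hc
    _ = ENNReal.ofReal (12 * z.im ^ (1 - k) * ∑' c : ℤ, 1 / (c : ℝ) ^ 2) := by
        rw [← tsum_mul_left, ENNReal.ofReal_tsum_of_nonneg (fun c ↦ by positivity)
          (hs.mul_left _)]
    _ ≤ _ := by
        refine ENNReal.ofReal_le_ofReal ?_
        nlinarith

/-! ### The Poincaré series -/

/-- The exponential `exp (2 π i z / h)`. -/
def expH (h : ℕ) (z : ℍ) : ℂ := Complex.exp (2 * Real.pi * Complex.I * z / h)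

lemma norm_expH (h : ℕ) (z : ℍ) : ‖expH h z‖ = Real.exp (-(2 * Real.pi * z.im / h)) := by
  rw [expH, Complex.norm_exp]
  congr 1
  rw [Complex.div_natCast_re]
  simp [neg_div]

lemma mdifferentiable_expH (h : ℕ) : MDiff (expH h) := by
  rw [UpperHalfPlane.mdifferentiable_iff]
  have h1 : DifferentiableOn ℂ (fun ζ : ℂ ↦ Complex.exp (2 * Real.pi * Complex.I * ζ / h))
      {z | 0 < z.im} := by fun_prop
  refine h1.congr fun ζ hζ ↦ ?_
  simp [expH, ofComplex_apply_of_im_pos hζ]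

lemma im_smul_eq_div (g : SL(2, ℤ)) (z : ℍ) :
    (g • z).im = z.im / ‖rowForm (g.1 1) z‖ ^ 2 := by
  rw [ModularGroup.im_smul_eq_div_normSq, Complex.normSq_eq_norm_sq, denom_eq_rowForm]

lemma norm_expH_slash (k : ℤ) (h : ℕ) (p : SL(2, ℤ)) (z : ℍ) :
    ‖(expH h ∣[k] p) z‖ =
      ‖rowForm (p.1 1) z‖ ^ (-k) * Real.exp (-(2 * Real.pi * (p • z).im / h)) := by
  rw [ModularForm.SL_slash_apply, norm_mul, norm_expH, norm_zpow, denom_eq_rowForm, mul_comm]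

/-- Right multiplication by a matrix, as a permutation of the integral rows. -/
def rowEquiv (g : SL(2, ℤ)) : (Fin 2 → ℤ) ≃ (Fin 2 → ℤ) where
  toFun v := Matrix.vecMul v g.1
  invFun v := Matrix.vecMul v (g⁻¹).1
  left_inv v := by
    dsimp only
    rw [Matrix.vecMul_vecMul, ← Matrix.SpecialLinearGroup.coe_mul, mul_inv_cancel]; simp
  right_inv v := by
    dsimp only
    rw [Matrix.vecMul_vecMul, ← Matrix.SpecialLinearGroup.coe_mul, inv_mul_cancel]; simp

lemma mul_row (p g : SL(2, ℤ)) : (p * g).1 1 = rowEquiv g (p.1 1) := by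
  rw [Matrix.SpecialLinearGroup.coe_mul]
  exact Matrix.mul_apply_eq_vecMul _ _ _

lemma mul_inv_apply_one_zero {p q : SL(2, ℤ)} (h : p.1 1 = q.1 1) : (p * q⁻¹).1 1 0 = 0 := by
  rw [Matrix.SpecialLinearGroup.coe_mul, Matrix.mul_apply, Fin.sum_univ_two,
    Matrix.SpecialLinearGroup.SL2_inv_expl, congrFun h 0, congrFun h 1]
  simp
  ring

/-- `exp (2 π i z / h)` is fixed by the weight `k` action of the stabilizer of `∞` in `G`. -/
def FixesExp (G : Subgroup SL(2, ℤ)) (k : ℤ) (h : ℕ) : Prop :=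
  ∀ g ∈ G, g.1 1 0 = 0 → expH h ∣[k] g = expH h

open Classical in
/-- The term of the Poincaré series which belongs to the row `v`: it is `expH h ∣[k] g` if `v` is
the bottom row of a matrix `g` of `G` (any one, if `FixesExp G k h`), and `0` otherwise. -/
def poincareTerm (G : Subgroup SL(2, ℤ)) (k : ℤ) (h : ℕ) (v : Fin 2 → ℤ) : ℍ → ℂ :=
  if hv : ∃ g ∈ G, g.1 1 = v then expH h ∣[k] hv.choose else 0

/-- The Poincaré series `∑ expH h ∣[k] g` over the bottom rows of the matrices `g` of `G`. -/
def poincare (G : Subgroup SL(2, ℤ)) (k : ℤ) (h : ℕ) (z : ℍ) : ℂ :=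
  ∑' v, poincareTerm G k h v z

section Poincare

variable {G : Subgroup SL(2, ℤ)} {k : ℤ} {h : ℕ}

lemma poincareTerm_row (hG : FixesExp G k h) {g : SL(2, ℤ)} (hg : g ∈ G) :
    poincareTerm G k h (g.1 1) = expH h ∣[k] g := by
  have hv : ∃ p ∈ G, p.1 1 = g.1 1 := ⟨g, hg, rfl⟩
  rw [poincareTerm, dif_pos hv]
  obtain ⟨hp, hpg⟩ := hv.choose_spec
  set p := hv.choose
  have := hG (g * p⁻¹) (mul_mem hg (inv_mem hp)) (mul_inv_apply_one_zero hpg.symm)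
  rw [← this, ← SlashAction.slash_mul, inv_mul_cancel_right, this]

lemma poincareTerm_eq_zero {v : Fin 2 → ℤ} (hv : ¬ ∃ g ∈ G, g.1 1 = v) :
    poincareTerm G k h v = 0 := dif_neg hv

lemma poincareTerm_slash (hG : FixesExp G k h) {γ : SL(2, ℤ)} (hγ : γ ∈ G) (v : Fin 2 → ℤ) :
    poincareTerm G k h v ∣[k] γ = poincareTerm G k h (rowEquiv γ v) := by
  by_cases hv : ∃ g ∈ G, g.1 1 = v
  · obtain ⟨g, hg, rfl⟩ := hv
    rw [poincareTerm_row hG hg, ← SlashAction.slash_mul, ← mul_row,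
      poincareTerm_row hG (mul_mem hg hγ)]
  · have hv' : ¬ ∃ g ∈ G, g.1 1 = rowEquiv γ v := by
      rintro ⟨g, hg, h1⟩
      refine hv ⟨g * γ⁻¹, mul_mem hg (inv_mem hγ), ?_⟩
      rw [mul_row, h1]
      exact (rowEquiv γ).symm_apply_apply v
    rw [poincareTerm_eq_zero hv, poincareTerm_eq_zero hv', SlashAction.zero_slash]

lemma poincare_slash_apply (g : SL(2, ℤ)) (z : ℍ) :
    (poincare G k h ∣[k] g) z = ∑' v, (poincareTerm G k h v ∣[k] g) z := by
  simp_rw [ModularForm.SL_slash_apply, poincare]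
  exact tsum_mul_right.symm

lemma poincare_slash (hG : FixesExp G k h) : ∀ γ ∈ G, poincare G k h ∣[k] γ = poincare G k h := by
  intro γ hγ
  ext z
  rw [poincare_slash_apply]
  simp_rw [poincareTerm_slash hG hγ]
  exact (rowEquiv γ).tsum_eq (fun v ↦ poincareTerm G k h v z)

/-- A majorant for `(expH h ∣[k] p) z`, as a function of the bottom row `u` of `p`. -/
def rowMajorant (k : ℤ) (h : ℕ) (u : Fin 2 → ℤ) (z : ℍ) : ℝ≥0∞ :=
  (if u 0 = 0 then 0 else ENNReal.ofReal (‖rowForm u z‖ ^ (-k))) +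
    ((if u = ![0, 1] then ENNReal.ofReal (Real.exp (-(2 * Real.pi * z.im / h))) else 0) +
      (if u = ![0, -1] then ENNReal.ofReal (Real.exp (-(2 * Real.pi * z.im / h))) else 0))

lemma enorm_expH_slash_le (p : SL(2, ℤ)) (z : ℍ) :
    ‖(expH h ∣[k] p) z‖ₑ ≤ rowMajorant k h (p.1 1) z := by
  unfold rowMajorant
  rw [← ofReal_norm, norm_expH_slash]
  by_cases hc : p.1 1 0 = 0
  · have hdet := p.2
    rw [Matrix.det_fin_two, hc, mul_zero, sub_zero] at hdet
    have hrow : p.1 1 = ![0, 1] ∨ p.1 1 = ![0, -1] := by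
      rcases Int.eq_one_or_neg_one_of_mul_eq_one' hdet with h1 | h1
      · left; ext i; fin_cases i; exacts [hc, h1.2]
      · right; ext i; fin_cases i; exacts [hc, h1.2]
    rw [im_smul_eq_div]
    rcases hrow with h1 | h1 <;> simp [h1, rowForm]
  · rw [if_neg hc]
    refine le_trans (ENNReal.ofReal_le_ofReal ?_) le_self_add
    refine mul_le_of_le_one_right (by positivity) (Real.exp_le_one_iff.mpr ?_)
    have := (p • z).im_pos
    rw [neg_nonpos]
    positivity

/-- The constant in the bound for the sum over rows. -/
def rowConst : ℝ := exists_tsum_rowForm_le.choose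

lemma rowConst_pos : 0 < rowConst := exists_tsum_rowForm_le.choose_spec.1

lemma tsum_rowForm_le (hk : 2 < k) {z : ℍ} (hz : 1 / 2 ≤ z.im) :
    ∑' u : Fin 2 → ℤ, (if u 0 = 0 then 0 else ENNReal.ofReal (‖rowForm u z‖ ^ (-k))) ≤
      ENNReal.ofReal (rowConst * z.im ^ (1 - k)) :=
  exists_tsum_rowForm_le.choose_spec.2 k hk z hz

lemma tsum_rowMajorant_le (hk : 2 < k) {z : ℍ} (hz : 1 / 2 ≤ z.im) :
    ∑' u, rowMajorant k h u z ≤ ENNReal.ofReal (rowConst * z.im ^ (1 - k) +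
      2 * Real.exp (-(2 * Real.pi * z.im / h))) := by
  have hy := z.im_pos
  have hR := rowConst_pos
  unfold rowMajorant
  rw [ENNReal.tsum_add, ENNReal.tsum_add, tsum_ite_eq, tsum_ite_eq,
    ENNReal.ofReal_add (by positivity) (by positivity), two_mul (Real.exp _),
    ENNReal.ofReal_add (by positivity) (by positivity)]
  exact add_le_add_left (tsum_rowForm_le hk hz) _

variable (G) in
/-- The bottom rows of the matrices of `G`. -/
def rows : Set (Fin 2 → ℤ) := {v | ∃ g ∈ G, g.1 1 = v}

lemma enorm_poincare_slash_le (hG : FixesExp G k h) (g : SL(2, ℤ)) (z : ℍ) :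
    ‖(poincare G k h ∣[k] g) z‖ₑ ≤ ∑' v : rows G, rowMajorant k h (rowEquiv g v) z := by
  rw [poincare_slash_apply]
  refine enorm_tsum_le_tsum_enorm.trans ?_
  rw [← tsum_subtype_eq_of_support_subset (s := rows G)]
  · refine ENNReal.tsum_le_tsum fun ⟨v, p, hp, hv⟩ ↦ ?_
    subst hv
    rw [poincareTerm_row hG hp, ← SlashAction.slash_mul, ← mul_row]
    exact enorm_expH_slash_le (p * g) z
  · intro v hv
    by_contra hrow
    refine hv ?_
    dsimp only
    rw [poincareTerm_eq_zero hrow, SlashAction.zero_slash]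
    simp

lemma norm_poincare_slash_le (hG : FixesExp G k h) (hk : 2 < k) (g : SL(2, ℤ)) {z : ℍ}
    (hz : 1 / 2 ≤ z.im) :
    ‖(poincare G k h ∣[k] g) z‖ ≤
      rowConst * z.im ^ (1 - k) + 2 * Real.exp (-(2 * Real.pi * z.im / h)) := by
  have hy := z.im_pos
  have hR := rowConst_pos
  rw [← ENNReal.ofReal_le_ofReal_iff (by positivity), ofReal_norm]
  refine (enorm_poincare_slash_le hG g z).trans (le_trans ?_ (tsum_rowMajorant_le hk hz))
  exact (ENNReal.tsum_comp_le_tsum_of_injective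
    ((rowEquiv g).injective.comp Subtype.val_injective) fun u ↦ rowMajorant k h u z)

lemma isZeroAtImInfty_poincare_slash (hG : FixesExp G k h) (hk : 2 < k) (h0 : 0 < h)
    (g : SL(2, ℤ)) : IsZeroAtImInfty (poincare G k h ∣[k] g) := by
  have h1 : Tendsto (fun y : ℝ ↦ rowConst * y ^ (1 - k) +
      2 * Real.exp (-(2 * Real.pi * y / h))) atTop (𝓝 (rowConst * 0 + 2 * 0)) := by
    refine (Tendsto.const_mul _ ?_).add (Tendsto.const_mul _ ?_)
    · exact tendsto_zpow_atTop_zero (by lia)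
    · refine Real.tendsto_exp_neg_atTop_nhds_zero.comp ?_
      have hh : (0 : ℝ) < h := by exact_mod_cast h0
      exact (tendsto_id.const_mul_atTop (by positivity)).atTop_div_const hh
  rw [mul_zero, mul_zero, add_zero] at h1
  refine squeeze_zero_norm' ?_ (h1.comp tendsto_comap)
  have : ∀ᶠ y : ℝ in atTop, 1 / 2 ≤ y := eventually_ge_atTop _
  filter_upwards [tendsto_comap.eventually this] with z hz
  exact norm_poincare_slash_le hG hk g hz

lemma mdifferentiable_poincareTerm (v : Fin 2 → ℤ) : MDiff (poincareTerm G k h v) := by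
  by_cases hv : ∃ g ∈ G, g.1 1 = v
  · rw [poincareTerm, dif_pos hv]
    exact mdifferentiable_slash (mdifferentiable_expH h) k _
  · rw [poincareTerm_eq_zero hv]
    exact mdifferentiable_const

lemma norm_poincareTerm_le (hG : FixesExp G k h) (v : Fin 2 → ℤ) (z : ℍ) :
    ‖poincareTerm G k h v z‖ ≤ ‖rowForm v z‖ ^ (-k) := by
  by_cases hv : ∃ g ∈ G, g.1 1 = v
  · obtain ⟨g, hg, rfl⟩ := hv
    rw [poincareTerm_row hG hg, norm_expH_slash]
    refine mul_le_of_le_one_right (by positivity) (Real.exp_le_one_iff.mpr ?_)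
    have := (g • z).im_pos
    rw [neg_nonpos]
    positivity
  · rw [poincareTerm_eq_zero hv]
    simp only [Pi.zero_apply, norm_zero]
    positivity

lemma mdifferentiable_poincare (hG : FixesExp G k h) (hk : 2 < k) : MDiff (poincare G k h) := by
  intro z
  rw [UpperHalfPlane.mdifferentiableAt_iff]
  have hk' : (2 : ℝ) < (k : ℝ) := by exact_mod_cast hk
  have hB : 0 < z.im / 2 := half_pos z.im_pos
  set U : Set ℂ := {ζ | |ζ.re| < |z.re| + 1 ∧ z.im / 2 < ζ.im} with hU
  have hUo : IsOpen U :=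
    (isOpen_lt (continuous_abs.comp Complex.continuous_re) continuous_const).inter
      (isOpen_lt continuous_const Complex.continuous_im)
  have hzU : (z : ℂ) ∈ U := ⟨by simp, by simpa using half_lt_self z.im_pos⟩
  have hsub : ∀ ζ ∈ U, 0 < ζ.im := fun ζ hζ ↦ hB.trans hζ.2
  have hs := (EisensteinSeries.summable_one_div_norm_rpow hk').mul_left
    (EisensteinSeries.r ⟨⟨|z.re| + 1, z.im / 2⟩, hB⟩ ^ (-(k : ℝ)))
  have hd := Complex.differentiableOn_tsum_of_summable_norm (U := U)
    (F := fun v ζ ↦ poincareTerm G k h v (ofComplex ζ)) hs ?_ hUo ?_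
  · exact (hd z hzU).differentiableAt (hUo.mem_nhds hzU)
  · intro v
    exact (UpperHalfPlane.mdifferentiable_iff.mp (mdifferentiable_poincareTerm v)).mono hsub
  · intro v ζ hζ
    refine (norm_poincareTerm_le hG v _).trans ?_
    have := EisensteinSeries.summand_bound_of_mem_verticalStrip (z := ofComplex ζ)
      (k := k) (by linarith) v (A := |z.re| + 1) hB (by
        rw [mem_verticalStrip_iff, ofComplex_apply_of_im_pos (hsub ζ hζ)]
        exact ⟨hζ.1.le, hζ.2.le⟩)
    rw [← Real.rpow_intCast, Int.cast_neg]
    exact this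

end Poincare

/-- The cusp form given by a function which is invariant, holomorphic and zero at all cusps. -/
def cuspFormOf {Γ : Subgroup SL(2, ℤ)} [Γ.FiniteIndex] {k : ℤ} (f : ℍ → ℂ)
    (hΓ : ∀ γ ∈ Γ, f ∣[k] γ = f) (hf : MDiff f)
    (h0 : ∀ g : SL(2, ℤ), IsZeroAtImInfty (f ∣[k] g)) : S Γ k where
  toFun := f
  slash_action_eq' := by
    rintro _ ⟨γ, hγ, rfl⟩
    exact hΓ γ hγ
  holo' := hf
  zero_at_cusps' := by
    intro c hc
    have hc' := (Subgroup.IsArithmetic.isCusp_iff_isCusp_SL2Z _).mp hc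
    exact (OnePoint.isZeroAt_iff_forall_SL2Z hc').mpr fun g _ ↦ h0 g

/-! ### The energy of the Poincaré series -/

/-- The invariant absolute value `y ^ (k / 2) |f(z)|`. -/
def anorm (k : ℤ) (f : ℍ → ℂ) (z : ℍ) : ℝ := √(pnorm k f z)

lemma anorm_nonneg (k : ℤ) (f : ℍ → ℂ) (z : ℍ) : 0 ≤ anorm k f z := Real.sqrt_nonneg _

lemma anorm_sq (k : ℤ) (f : ℍ → ℂ) (z : ℍ) : anorm k f z ^ 2 = pnorm k f z :=
  Real.sq_sqrt (pnorm_nonneg k f z)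

lemma anorm_eq (k : ℤ) (f : ℍ → ℂ) (z : ℍ) :
    anorm k f z = z.im ^ ((k : ℝ) / 2) * ‖f z‖ := by
  have hy := z.im_pos
  rw [anorm, pnorm, Real.sqrt_mul (zpow_pos hy k).le, Real.sqrt_sq (norm_nonneg _),
    Real.sqrt_eq_rpow, ← Real.rpow_intCast, ← Real.rpow_mul hy.le]
  congr 2
  ring

lemma anorm_slash (k : ℤ) (f : ℍ → ℂ) (g : SL(2, ℤ)) (z : ℍ) :
    anorm k (f ∣[k] g) z = anorm k f (g • z) := by
  rw [anorm, anorm, pnorm_slash]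

lemma ofReal_anorm (k : ℤ) (f : ℍ → ℂ) (z : ℍ) :
    ENNReal.ofReal (anorm k f z) = ENNReal.ofReal (z.im ^ ((k : ℝ) / 2)) * ‖f z‖ₑ := by
  rw [anorm_eq, ENNReal.ofReal_mul (Real.rpow_nonneg z.im_pos.le _), ofReal_norm]

/-- Two matrices with the same bottom row differ by a translation. -/
lemma exists_eq_T_zpow_mul {p q : SL(2, ℤ)} (h : p.1 1 = q.1 1) :
    p = ModularGroup.T ^ ((p * q⁻¹).1 0 1) * q := by
  have hrow : (p * q⁻¹).1 1 = (1 : SL(2, ℤ)).1 1 := by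
    rw [mul_row, h, ← mul_row, mul_inv_cancel]
  have h10 : (p * q⁻¹).1 1 0 = 0 := by simp [hrow]
  have h11 : (p * q⁻¹).1 1 1 = 1 := by simp [hrow]
  have hdet := (p * q⁻¹).2
  rw [Matrix.det_fin_two, h10, h11, mul_one, mul_zero, sub_zero] at hdet
  rw [← mul_inv_eq_iff_eq_mul]
  refine Subtype.ext (Eq.trans ?_ (ModularGroup.coe_T_zpow _).symm)
  ext i j
  fin_cases i <;> fin_cases j
  exacts [hdet, rfl, h10, h11]

/-- Given the coset `q` and the row `v` of `δ ∈ G`, the row `u` of `δ (out q)⁻¹` determines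
`δ (out q)⁻¹` up to translation, and so `(q, v)` up to at most `w` choices, `w` being the
width of the cusp `∞`. -/
lemma tsum_coset_rows_le {G : Subgroup SL(2, ℤ)} {w : ℕ} (hw0 : 0 < w)
    (hw : ∀ m : ℤ, (w : ℤ) ∣ m → ModularGroup.T ^ m ∈ pm G) (a : (Fin 2 → ℤ) → ℝ≥0∞) :
    ∑' q : SL(2, ℤ) ⧸ pm G, ∑' v : rows G, a (rowEquiv (Quotient.out q)⁻¹ v) ≤
      w * ∑' u, a u := by
  classical
  have : NeZero w := ⟨hw0.ne'⟩
  choose δ hδ hδv using fun v : rows G ↦ v.2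
  let β : (Fin 2 → ℤ) → SL(2, ℤ) := fun u ↦ if hu : ∃ p : SL(2, ℤ), p.1 1 = u then hu.choose else 1
  have hβ : ∀ p : SL(2, ℤ), (β (p.1 1)).1 1 = p.1 1 := fun p ↦ by
    have hu : ∃ p' : SL(2, ℤ), p'.1 1 = p.1 1 := ⟨p, rfl⟩
    simp only [β, dif_pos hu]
    exact hu.choose_spec
  let P : (SL(2, ℤ) ⧸ pm G) × rows G → SL(2, ℤ) := fun x ↦ δ x.2 * (Quotient.out x.1)⁻¹
  let m : (SL(2, ℤ) ⧸ pm G) × rows G → ℤ := fun x ↦ (P x * (β ((P x).1 1))⁻¹).1 0 1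
  have hP : ∀ x, P x = ModularGroup.T ^ m x * β ((P x).1 1) := fun x ↦
    exists_eq_T_zpow_mul (hβ (P x)).symm
  have hrow : ∀ x, (P x).1 1 = rowEquiv (Quotient.out x.1)⁻¹ x.2 := fun x ↦ by
    rw [← hδv x.2]; exact mul_row _ _
  let φ : (SL(2, ℤ) ⧸ pm G) × rows G → (Fin 2 → ℤ) × ZMod w := fun x ↦ ((P x).1 1, (m x : ZMod w))
  have hφ : Function.Injective φ := by
    rintro x y hxy
    obtain ⟨h1, h2⟩ := Prod.ext_iff.mp hxy
    have h1 : (P x).1 1 = (P y).1 1 := h1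
    have h2 : (m x : ZMod w) = (m y : ZMod w) := h2
    rw [ZMod.intCast_eq_intCast_iff_dvd_sub] at h2
    have h3 : P y * (P x)⁻¹ = ModularGroup.T ^ (m y - m x) := by
      rw [hP x, hP y, h1, zpow_sub]; group
    have h4 := hw _ h2
    rw [← h3] at h4
    have h5 : (Quotient.out y.1)⁻¹ * Quotient.out x.1 ∈ pm G := by
      have h6 := mul_mem (mul_mem (inv_mem (mem_pm.mpr (Or.inl (hδ y.2)))) h4)
        (mem_pm.mpr (Or.inl (hδ x.2)))
      convert h6 using 1
      simp only [P]
      group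
    have h7 : x.1 = y.1 := by
      rw [← QuotientGroup.out_eq' x.1, ← QuotientGroup.out_eq' y.1]
      exact (QuotientGroup.eq.mpr h5).symm
    rw [hrow, hrow, h7] at h1
    exact Prod.ext h7 (Subtype.ext ((rowEquiv _).injective h1))
  calc _ = ∑' x, a (φ x).1 := by
        rw [← ENNReal.tsum_prod]
        exact tsum_congr fun x ↦ congrArg a (hrow x).symm
    _ ≤ ∑' y : (Fin 2 → ℤ) × ZMod w, a y.1 :=
        ENNReal.tsum_comp_le_tsum_of_injective hφ fun y ↦ a y.1
    _ = _ := by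
        rw [ENNReal.tsum_prod', ← ENNReal.tsum_mul_left]
        refine tsum_congr fun u ↦ ?_
        rw [tsum_fintype]
        simp

lemma measurable_rowMajorant (k : ℤ) (h : ℕ) (u : Fin 2 → ℤ) : Measurable (rowMajorant k h u) := by
  have h1 : Continuous (rowForm u) := by unfold rowForm; fun_prop
  have h2 : Measurable fun z : ℍ ↦ ‖rowForm u z‖ ^ (-k) := by
    have := h1.norm.measurable
    exact this.pow_const _
  have h3 : Measurable fun z : ℍ ↦ Real.exp (-(2 * Real.pi * z.im / h)) := by
    have := UpperHalfPlane.continuous_im.measurable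
    fun_prop
  unfold rowMajorant
  refine Measurable.add ?_ (Measurable.add ?_ ?_)
  · split_ifs
    exacts [measurable_const, h2.ennreal_ofReal]
  · split_ifs
    exacts [h3.ennreal_ofReal, measurable_const]
  · split_ifs
    exacts [h3.ennreal_ofReal, measurable_const]

lemma lintegral_Ioi_rpow_mul_exp_le {a r b : ℝ} (ha : 0 < a) (hr : 0 < r) (hb : 0 ≤ b) :
    ∫⁻ y in Set.Ioi b, ENNReal.ofReal (y ^ (a - 1) * Real.exp (-(r * y))) ≤
      ENNReal.ofReal ((1 / r) ^ a * Real.Gamma a) := by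
  have hi := Real.integral_rpow_mul_exp_neg_mul_Ioi ha hr
  have hG := Real.Gamma_pos_of_pos ha
  have hint : IntegrableOn (fun y : ℝ ↦ y ^ (a - 1) * Real.exp (-(r * y))) (Set.Ioi 0) := by
    refine Integrable.of_integral_ne_zero ?_
    rw [hi]
    positivity
  rw [← hi, ofReal_integral_eq_lintegral_ofReal hint]
  · exact lintegral_mono_set (Set.Ioi_subset_Ioi hb)
  · filter_upwards [ae_restrict_mem measurableSet_Ioi] with y hy
    have : 0 < y := hy
    positivity

/-- The bound for the energy of the Poincaré series divided by its supremum `M` and by the width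
`w`. -/
def energyBound (k : ℤ) (h : ℕ) : ℝ :=
  rowConst * (2 ^ ((k : ℝ) / 2) / (k / 2)) +
    2 * ((h / (2 * Real.pi)) ^ ((k : ℝ) / 2 - 1) * Real.Gamma ((k : ℝ) / 2 - 1))

/-- One factor `y ^ (k / 2) |Q|` is estimated by its supremum `M`, and the other one is unfolded into
a sum over the bottom rows of `SL(2, ℤ)`. -/
lemma energy_poincare_le {G : Subgroup SL(2, ℤ)} [G.FiniteIndex] {k : ℤ} {h w : ℕ}
    (hG : FixesExp G k h) (hk : 2 < k) (h0 : 0 < h) (hw0 : 0 < w)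
    (hw : ∀ m : ℤ, (w : ℤ) ∣ m → ModularGroup.T ^ m ∈ pm G) {M : ℝ}
    (hM : ∀ z, anorm k (poincare G k h) z ≤ M) :
    energy G k (poincare G k h) ≤ ENNReal.ofReal (M * (w * energyBound k h)) := by
  have hM0 : 0 ≤ M := (anorm_nonneg _ _ UpperHalfPlane.I).trans (hM _)
  have hR := rowConst_pos
  have hk' : (2 : ℝ) < k := by exact_mod_cast hk
  have hh : (0 : ℝ) < h := by exact_mod_cast h0
  set Q := poincare G k h with hQ
  have hy : Measurable fun z : ℍ ↦ ENNReal.ofReal (z.im ^ ((k : ℝ) / 2)) := by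
    have := UpperHalfPlane.continuous_im.measurable
    fun_prop
  have hmeas : ∀ q : SL(2, ℤ) ⧸ pm G, Measurable fun z ↦ ENNReal.ofReal M *
      (ENNReal.ofReal (z.im ^ ((k : ℝ) / 2)) *
        ∑' v : rows G, rowMajorant k h (rowEquiv (Quotient.out q)⁻¹ v) z) := fun q ↦
    (hy.mul (Measurable.tsum fun v ↦ measurable_rowMajorant k h _)).const_mul _
  calc energy G k Q = ∑' q, cosetIntegral G (fun z ↦ ENNReal.ofReal (pnorm k Q z)) q :=
        lintegral_fundDomain G _
    _ ≤ ∑' q : SL(2, ℤ) ⧸ pm G, ∫⁻ z in ModularGroup.fd, ENNReal.ofReal M *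
          (ENNReal.ofReal (z.im ^ ((k : ℝ) / 2)) *
            ∑' v : rows G, rowMajorant k h (rowEquiv (Quotient.out q)⁻¹ v) z) := by
        refine ENNReal.tsum_le_tsum fun q ↦ lintegral_mono fun z ↦ ?_
        dsimp only
        rw [← anorm_sq, sq, ENNReal.ofReal_mul (anorm_nonneg _ _ _)]
        refine mul_le_mul' (ENNReal.ofReal_le_ofReal (hM _)) ?_
        rw [← anorm_slash, ofReal_anorm]
        exact mul_le_mul_right (enorm_poincare_slash_le hG _ z) _
    _ = ∫⁻ z in ModularGroup.fd, ENNReal.ofReal M * (ENNReal.ofReal (z.im ^ ((k : ℝ) / 2)) *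
          ∑' q : SL(2, ℤ) ⧸ pm G, ∑' v : rows G,
            rowMajorant k h (rowEquiv (Quotient.out q)⁻¹ v) z) := by
        rw [← lintegral_tsum fun q ↦ (hmeas q).aemeasurable]
        simp_rw [ENNReal.tsum_mul_left]
    _ ≤ ∫⁻ z in ModularGroup.fd, ENNReal.ofReal (M * w) *
          ENNReal.ofReal (z.im ^ ((k : ℝ) / 2) * (rowConst * z.im ^ (1 - k) +
            2 * Real.exp (-(2 * Real.pi * z.im / h)))) := by
        refine setLIntegral_mono' measurableSet_fd fun z hz ↦ ?_
        have hz2 : 1 / 2 ≤ z.im := by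
          have h1 := ModularGroup.three_le_four_mul_im_sq_of_mem_fd hz
          have h2 := z.im_pos
          nlinarith
        have h1 := (tsum_coset_rows_le hw0 hw fun u ↦ rowMajorant k h u z).trans
          (mul_le_mul_right (tsum_rowMajorant_le hk hz2) _)
        rw [ENNReal.ofReal_mul hM0, ENNReal.ofReal_natCast,
          ENNReal.ofReal_mul (Real.rpow_nonneg z.im_pos.le _)]
        calc _ ≤ _ := mul_le_mul_right (mul_le_mul_right h1 _) _
          _ = _ := by ring
    _ = ENNReal.ofReal (M * w) * ∫⁻ z in ModularGroup.fd,
          ENNReal.ofReal (z.im ^ ((k : ℝ) / 2) * (rowConst * z.im ^ (1 - k) +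
            2 * Real.exp (-(2 * Real.pi * z.im / h)))) :=
        lintegral_const_mul' _ _ ENNReal.ofReal_ne_top
    _ ≤ ENNReal.ofReal (M * w) * ENNReal.ofReal (energyBound k h) := by
        refine mul_le_mul_right ?_ _
        refine (setLIntegral_fd_le (u := fun y ↦ ENNReal.ofReal (y ^ ((k : ℝ) / 2) *
          (rowConst * y ^ (1 - k) + 2 * Real.exp (-(2 * Real.pi * y / h)))))
          (by fun_prop)).trans ?_
        have hsplit : ∀ y ∈ Set.Ioi (1 / 2 : ℝ), ENNReal.ofReal (1 / y ^ 2) *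
            ENNReal.ofReal (y ^ ((k : ℝ) / 2) *
              (rowConst * y ^ (1 - k) + 2 * Real.exp (-(2 * Real.pi * y / h)))) =
            ENNReal.ofReal rowConst * ENNReal.ofReal (y ^ (-(1 + (k : ℝ) / 2))) +
            2 * ENNReal.ofReal (y ^ ((k : ℝ) / 2 - 1 - 1) *
              Real.exp (-(2 * Real.pi / h * y))) := by
          intro y hy
          have hy0 : 0 < y := by have : 1 / 2 < y := hy; linarith
          rw [← ENNReal.ofReal_mul hR.le, ← ENNReal.ofReal_mul (by positivity),
            show (2 : ℝ≥0∞) = ENNReal.ofReal 2 by simp, ← ENNReal.ofReal_mul (by norm_num),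
            ← ENNReal.ofReal_add (by positivity) (by positivity)]
          congr 1
          have e1 : y ^ (-(1 + (k : ℝ) / 2)) = 1 / y ^ 2 * y ^ ((k : ℝ) / 2) * y ^ (1 - k) := by
            rw [← Real.rpow_intCast y (1 - k), one_div, ← Real.rpow_natCast y 2,
              ← Real.rpow_neg hy0.le, ← Real.rpow_add hy0, ← Real.rpow_add hy0]
            congr 1
            push_cast
            ring
          have e2 : y ^ ((k : ℝ) / 2 - 1 - 1) = 1 / y ^ 2 * y ^ ((k : ℝ) / 2) := by
            rw [one_div, ← Real.rpow_natCast y 2, ← Real.rpow_neg hy0.le, ← Real.rpow_add hy0]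
            congr 1
            push_cast
            ring
          rw [e1, e2, show 2 * Real.pi / h * y = 2 * Real.pi * y / h by ring]
          ring
        rw [setLIntegral_congr_fun measurableSet_Ioi hsplit, lintegral_add_left (by fun_prop),
          lintegral_const_mul' _ _ ENNReal.ofReal_ne_top,
          lintegral_const_mul' _ _ (by norm_num), lintegral_Ioi_rpow (by linarith) (by norm_num)]
        have h2 := lintegral_Ioi_rpow_mul_exp_le (a := (k : ℝ) / 2 - 1) (r := 2 * Real.pi / h)
          (b := 1 / 2) (by linarith) (by positivity) (by norm_num)
        have hGa := Real.Gamma_pos_of_pos (show 0 < (k : ℝ) / 2 - 1 by linarith)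
        refine (add_le_add le_rfl (mul_le_mul_right h2 2)).trans_eq ?_
        have hk2 : (0 : ℝ) < k / 2 := by linarith
        have e3 : (1 / 2 : ℝ) ^ (1 - (1 + (k : ℝ) / 2)) / (1 + (k : ℝ) / 2 - 1) =
            2 ^ ((k : ℝ) / 2) / (k / 2) := by
          rw [show 1 - (1 + (k : ℝ) / 2) = -((k : ℝ) / 2) by ring, Real.rpow_neg (by norm_num),
            ← Real.inv_rpow (by norm_num), add_sub_cancel_left]
          norm_num
        rw [e3, one_div_div, show (2 : ℝ≥0∞) = ENNReal.ofReal 2 by simp,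
          ← ENNReal.ofReal_mul hR.le, ← ENNReal.ofReal_mul (by norm_num),
          ← ENNReal.ofReal_add (by positivity) (by positivity), energyBound]
    _ = _ := by rw [← ENNReal.ofReal_mul (by positivity), mul_assoc]

/-! ### A bound for the Gamma function -/

/-- The inductive step for the Stirling type bound `Γ(m - 1) ≤ C m ^ (m - 3 / 2) e ^ (-m)`. -/
lemma gamma_step {C m : ℝ} (hC : 0 < C) (hm : 1 < m)
    (h : Real.Gamma (m - 1) ≤ C * (m ^ (m - 3 / 2) * Real.exp (-m))) :
    Real.Gamma (m + 1 - 1) ≤ C * ((m + 1) ^ (m + 1 - 3 / 2) * Real.exp (-(m + 1))) := by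
  have hm0 : 0 < m := by linarith
  set x := 1 / m with hx
  have hx0 : 0 < x := by positivity
  have hmx : m * x = 1 := by rw [hx]; field_simp
  -- The comparison of consecutive terms, from `2 x / (x + 2) ≤ log (1 + x)`.
  have key : (1 - x) * Real.exp 1 ≤ (1 + x) ^ (m - 1 / 2) := by
    have hlog := Real.le_log_one_add_of_nonneg hx0.le
    calc (1 - x) * Real.exp 1 ≤ Real.exp (-x) * Real.exp 1 := by
          gcongr
          have := Real.add_one_le_exp (-x)
          linarith
      _ = Real.exp (1 - x) := by rw [← Real.exp_add]; congr 1; ring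
      _ ≤ Real.exp (Real.log (1 + x) * (m - 1 / 2)) := by
          refine Real.exp_le_exp.mpr ?_
          calc 1 - x ≤ 2 * x / (x + 2) * (m - 1 / 2) := by
                rw [div_mul_eq_mul_div, le_div_iff₀ (by positivity)]
                nlinarith
            _ ≤ _ := by gcongr; linarith
      _ = _ := by rw [Real.rpow_def_of_pos (by positivity)]
  have hsplit : (m + 1) ^ (m + 1 - 3 / 2) = m * (m ^ (m - 3 / 2) * (1 + x) ^ (m - 1 / 2)) := by
    rw [show m + 1 = m * (1 + x) by rw [mul_add, hmx, mul_one],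
      show m * (1 + x) - 3 / 2 = m - 1 / 2 by rw [mul_add, hmx]; ring,
      Real.mul_rpow hm0.le (by positivity), show m - 1 / 2 = 1 + (m - 3 / 2) by ring,
      Real.rpow_add hm0, Real.rpow_one]
    ring
  have hG : Real.Gamma (m + 1 - 1) = (m - 1) * Real.Gamma (m - 1) := by
    rw [show m + 1 - 1 = (m - 1) + 1 by ring, Real.Gamma_add_one (by linarith)]
  rw [hG, hsplit, neg_add, Real.exp_add]
  have he : Real.exp 1 * Real.exp (-1) = 1 := by rw [← Real.exp_add]; simp
  calc (m - 1) * Real.Gamma (m - 1) ≤ (m - 1) * (C * (m ^ (m - 3 / 2) * Real.exp (-m))) := by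
        gcongr
    _ = C * m * m ^ (m - 3 / 2) * Real.exp (-m) * Real.exp (-1) * ((1 - x) * Real.exp 1) := by
        have : (m - 1) = m * (1 - x) := by rw [mul_sub, hmx, mul_one]
        rw [this]
        linear_combination (-(C * m * m ^ (m - 3 / 2) * Real.exp (-m) * (1 - x))) * he
    _ ≤ C * m * m ^ (m - 3 / 2) * Real.exp (-m) * Real.exp (-1) * (1 + x) ^ (m - 1 / 2) := by
        gcongr
    _ = _ := by ring

lemma exists_gamma_le : ∃ C : ℝ, 0 < C ∧ ∀ k : ℤ, 2 < k →
    Real.Gamma ((k : ℝ) / 2 - 1) ≤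
      C * (((k : ℝ) / 2) ^ ((k : ℝ) / 2 - 3 / 2) * Real.exp (-((k : ℝ) / 2))) := by
  let b : ℝ → ℝ := fun m ↦ m ^ (m - 3 / 2) * Real.exp (-m)
  let C : ℝ := 1 + (Real.Gamma (3 / 2 - 1) / b (3 / 2) + Real.Gamma (2 - 1) / b 2)
  have hb : ∀ m : ℝ, 0 < m → 0 < b m := fun m hm ↦ by positivity
  have three_half_pos : (0 : ℝ) < 3 / 2 := by norm_num
  have hg1 : 0 < Real.Gamma (3 / 2 - 1) / b (3 / 2) :=
    div_pos (Real.Gamma_pos_of_pos (by norm_num)) (hb _ (by norm_num))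
  have hg2 : 0 < Real.Gamma (2 - 1) / b 2 :=
    div_pos (Real.Gamma_pos_of_pos (by norm_num)) (hb _ (by norm_num))
  have hC : 0 < C := by positivity
  have hmax : ∀ s t : ℝ, 0 < s → 0 < t → s ≤ 1 + (s + t) ∧ t ≤ 1 + (s + t) :=
    fun s t hs ht ↦ ⟨by linarith, by linarith⟩
  have main : ∀ n : ℕ, Real.Gamma ((3 + n) / 2 - 1) ≤ C * b ((3 + n) / 2) := by
    intro n
    induction n using Nat.twoStepInduction with
    | zero =>
      have e : (3 + ((0 : ℕ) : ℝ)) / 2 = 3 / 2 := by rw [Nat.cast_zero, add_zero]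
      rw [e, ← div_le_iff₀ (hb _ three_half_pos)]
      exact (hmax _ _ hg1 hg2).1
    | one =>
      have e : (3 + ((1 : ℕ) : ℝ)) / 2 = 2 := by rw [Nat.cast_one]; norm_num
      rw [e, ← div_le_iff₀ (hb _ two_pos)]
      exact (hmax _ _ hg1 hg2).2
    | more n ih _ =>
      have hn : (0 : ℝ) ≤ n := n.cast_nonneg
      have e : ∀ t : ℝ, (3 + (t + 2)) / 2 = (3 + t) / 2 + 1 := fun t ↦ by ring
      rw [Nat.cast_add, Nat.cast_two, e]
      exact gamma_step hC (by linarith) ih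
  refine ⟨C, hC, fun k hk ↦ ?_⟩
  have h := main (k - 3).toNat
  have hk3 : (3 + ((k - 3).toNat : ℝ)) = k := by
    have : (((k - 3).toNat : ℤ) : ℝ) = ((k - 3 : ℤ) : ℝ) := by rw [Int.toNat_of_nonneg (by lia)]
    rw [Int.cast_natCast, Int.cast_sub] at this
    rw [this, Int.cast_ofNat, add_sub_cancel]
  rwa [hk3] at h

/-- The bound for the energy against the value at the height `k h / (4 π)` at which the first term
of the Poincaré series is extremal. -/
lemma exists_energyBound_le : ∃ C : ℝ, 0 < C ∧ ∀ (k : ℤ) (h : ℕ), 2 < k → 0 < h →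
    2 * Real.exp 1 ≤ k * h / (4 * Real.pi) →
    (k : ℝ) ^ (3 / 2 : ℝ) * (h * energyBound k h) ≤
      C * ((k * h / (4 * Real.pi)) ^ ((k : ℝ) / 2) * Real.exp (-((k : ℝ) / 2))) := by
  obtain ⟨C, hC, hΓ⟩ := exists_gamma_le
  have hR := rowConst_pos
  refine ⟨2 ^ (3 / 2 : ℝ) * (2 * Real.pi * (rowConst * (2 * Real.exp 1)) + 4 * Real.pi * C),
    by positivity, fun k h hk h0 hy ↦ ?_⟩
  have hk' : (2 : ℝ) < k := by exact_mod_cast hk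
  have hh : (0 : ℝ) < h := by exact_mod_cast h0
  have hg := hΓ k hk
  set m : ℝ := (k : ℝ) / 2 with hm
  have hm1 : 1 < m := by rw [hm]; linarith
  have hm0 : 0 < m := by linarith
  set X : ℝ := h / (2 * Real.pi) with hX
  have hX0 : 0 < X := by positivity
  have hhX : (h : ℝ) = 2 * Real.pi * X := by rw [hX]; field_simp
  have hyX : k * h / (4 * Real.pi) = m * X := by rw [hm, hX]; field_simp; ring
  rw [hyX] at hy ⊢
  have hk32 : (k : ℝ) ^ (3 / 2 : ℝ) = 2 ^ (3 / 2 : ℝ) * m ^ (3 / 2 : ℝ) := by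
    rw [← Real.mul_rpow (by norm_num) hm0.le]; congr 1; rw [hm]; ring
  set V : ℝ := (m * X) ^ m * Real.exp (-m) with hV
  have hVe : V = (m * X / Real.exp 1) ^ m := by
    rw [hV, Real.div_rpow (by positivity) (Real.exp_pos 1).le, Real.exp_one_rpow, Real.exp_neg,
      div_eq_mul_inv]
  -- the contribution of the rows with nonzero first entry
  have h1 : m ^ (3 / 2 : ℝ) * (X * (2 ^ m / m)) ≤ 2 * Real.exp 1 * V := by
    have e1 : m ^ (3 / 2 : ℝ) ≤ m * m := by
      rw [← sq, ← Real.rpow_natCast]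
      exact Real.rpow_le_rpow_of_exponent_le hm1.le (by norm_num)
    have e2 : (2 : ℝ) ^ m = 2 * 2 ^ (m - 1) := by
      rw [← Real.rpow_one_add' (by norm_num) (by linarith)]; congr 1; ring
    have e3 : V = m * X / Real.exp 1 * (m * X / Real.exp 1) ^ (m - 1) := by
      rw [hVe, ← Real.rpow_one_add' (by positivity) (by linarith)]; congr 1; ring
    have e4 : (2 : ℝ) ^ (m - 1) ≤ (m * X / Real.exp 1) ^ (m - 1) := by
      refine Real.rpow_le_rpow (by norm_num) ?_ (by linarith)
      rwa [le_div_iff₀ (Real.exp_pos 1)]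
    calc m ^ (3 / 2 : ℝ) * (X * (2 ^ m / m)) ≤ m * m * (X * (2 ^ m / m)) := by gcongr
      _ = 2 * (m * X) * 2 ^ (m - 1) := by rw [e2]; field_simp
      _ ≤ 2 * (m * X) * (m * X / Real.exp 1) ^ (m - 1) := by gcongr
      _ = _ := by rw [e3]; field_simp
  -- the contribution of the rows with first entry zero
  have h2 : m ^ (3 / 2 : ℝ) * (X * (X ^ (m - 1) * Real.Gamma (m - 1))) ≤ C * V := by
    have e1 : X * X ^ (m - 1) = X ^ m := by
      rw [← Real.rpow_one_add' hX0.le (by linarith)]; congr 1; ring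
    have e2 : m ^ (3 / 2 : ℝ) * m ^ (m - 3 / 2) = m ^ m := by
      rw [← Real.rpow_add hm0]; congr 1; ring
    calc m ^ (3 / 2 : ℝ) * (X * (X ^ (m - 1) * Real.Gamma (m - 1)))
        ≤ m ^ (3 / 2 : ℝ) * (X * (X ^ (m - 1) * (C * (m ^ (m - 3 / 2) * Real.exp (-m))))) := by
          gcongr
      _ = C * ((m ^ (3 / 2 : ℝ) * m ^ (m - 3 / 2)) * (X * X ^ (m - 1)) * Real.exp (-m)) := by ring
      _ = C * V := by rw [e1, e2, hV, Real.mul_rpow hm0.le hX0.le]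
  rw [hk32, hhX, energyBound, ← hX, ← hm]
  calc _ = 2 ^ (3 / 2 : ℝ) * (2 * Real.pi * (rowConst * (m ^ (3 / 2 : ℝ) * (X * (2 ^ m / m)))) +
        4 * Real.pi * (m ^ (3 / 2 : ℝ) * (X * (X ^ (m - 1) * Real.Gamma (m - 1))))) := by ring
    _ ≤ 2 ^ (3 / 2 : ℝ) * (2 * Real.pi * (rowConst * (2 * Real.exp 1 * V)) +
        4 * Real.pi * (C * V)) := by gcongr
    _ = _ := by ring

/-! ### The lower bound at a wide cusp -/

/-- The terms of the rows `(0, ±1)` add up to one or two copies of the exponential, and the other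
terms are small high in the cusp. -/
lemma norm_poincare_ge {G : Subgroup SL(2, ℤ)} {k : ℤ} {h : ℕ} (hG : FixesExp G k h) (hk : 2 < k)
    {z : ℍ} (hz : 1 / 2 ≤ z.im) :
    Real.exp (-(2 * Real.pi * z.im / h)) - rowConst * z.im ^ (1 - k) ≤ ‖poincare G k h z‖ := by
  have hR := rowConst_pos
  have hy := z.im_pos
  set a : (Fin 2 → ℤ) → ℂ := fun v ↦ poincareTerm G k h v z with ha
  set s : Finset (Fin 2 → ℤ) := {![0, 1], ![0, -1]} with hs
  have hrow : ∀ v, v ∉ s → ‖a v‖ₑ ≤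
      if v 0 = 0 then 0 else ENNReal.ofReal (‖rowForm v z‖ ^ (-k)) := by
    intro v hv
    simp only [hs, Finset.mem_insert, Finset.mem_singleton, not_or] at hv
    by_cases hvG : v ∈ rows G
    · obtain ⟨g, hg, rfl⟩ := hvG
      have := enorm_expH_slash_le (k := k) (h := h) g z
      rw [← poincareTerm_row hG hg, rowMajorant, if_neg hv.1, if_neg hv.2, add_zero,
        add_zero] at this
      exact this
    · simp only [ha]
      rw [poincareTerm_eq_zero hvG]
      simp
  have hfin : ∑' v, ‖a v‖ₑ ≠ ⊤ := by
    have h1 := (ENNReal.tsum_le_tsum fun v ↦ show ‖a v‖ₑ ≤ rowMajorant k h v z by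
      by_cases hvG : v ∈ rows G
      · obtain ⟨g, hg, rfl⟩ := hvG
        simp only [ha]
        rw [poincareTerm_row hG hg]
        exact enorm_expH_slash_le g z
      · simp only [ha]
        rw [poincareTerm_eq_zero hvG]
        simp).trans (tsum_rowMajorant_le hk hz)
    exact (h1.trans_lt ENNReal.ofReal_lt_top).ne
  have hsum : Summable a := Summable.of_enorm hfin
  have hmain : Real.exp (-(2 * Real.pi * z.im / h)) ≤ ‖∑ v ∈ s, a v‖ := by
    rw [hs, Finset.sum_pair (by decide)]
    have h1 : a ![0, 1] = expH h z := by
      have hrow1 : (1 : SL(2, ℤ)).1 1 = ![0, 1] := by ext i; fin_cases i <;> rfl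
      simp only [ha]
      rw [← hrow1, poincareTerm_row hG (one_mem G), SlashAction.slash_one]
    have h2 : a ![0, -1] = expH h z ∨ a ![0, -1] = 0 := by
      by_cases hvG : ![0, -1] ∈ rows G
      · obtain ⟨g, hg, hgv⟩ := hvG
        left
        simp only [ha]
        rw [← hgv, poincareTerm_row hG hg, hG g hg (by rw [hgv]; rfl)]
      · right
        simp only [ha]
        rw [poincareTerm_eq_zero hvG]
        rfl
    rw [← norm_expH, h1]
    rcases h2 with h2 | h2 <;> rw [h2]
    · rw [← two_mul, norm_mul, Complex.norm_ofNat]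
      linarith [norm_nonneg (expH h z)]
    · rw [add_zero]
  have hrest : ‖∑' v : {v // v ∉ s}, a v‖ ≤ rowConst * z.im ^ (1 - k) := by
    rw [← ENNReal.ofReal_le_ofReal_iff (by positivity), ofReal_norm]
    refine enorm_tsum_le_tsum_enorm.trans (le_trans ?_ (tsum_rowForm_le hk hz))
    refine (ENNReal.tsum_le_tsum fun v : {v // v ∉ s} ↦ hrow v v.2).trans ?_
    exact ENNReal.tsum_comp_le_tsum_of_injective Subtype.val_injective fun v : Fin 2 → ℤ ↦
      if v 0 = 0 then 0 else ENNReal.ofReal (‖rowForm v z‖ ^ (-k))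
  have hdecomp : poincare G k h z = ∑ v ∈ s, a v + ∑' v : {v // v ∉ s}, a v :=
    (hsum.sum_add_tsum_subtype_compl s).symm
  rw [hdecomp]
  have := norm_sub_le_norm_add (∑ v ∈ s, a v) (∑' v : {v // v ∉ s}, a v)
  linarith

/-- The lower bound, when `k h` is large: a point at which the Poincaré series is at least half its
supremum. -/
lemma exists_poincare_lower : ∃ c K : ℝ, 0 < c ∧ 0 < K ∧ ∀ (G : Subgroup SL(2, ℤ)) [G.FiniteIndex]
    (k : ℤ) (h w : ℕ), FixesExp G k h → 2 < k → 0 < w → w ≤ h →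
    (∀ m : ℤ, (w : ℤ) ∣ m → ModularGroup.T ^ m ∈ pm G) → K ≤ k * h →
    ∃ z, 0 < pnorm k (poincare G k h) z ∧
      ENNReal.ofReal (c * (k : ℝ) ^ (3 / 2 : ℝ)) * energy G k (poincare G k h) ≤
        ENNReal.ofReal (pnorm k (poincare G k h) z) := by
  obtain ⟨C, hC, hbound⟩ := exists_energyBound_le
  have hR := rowConst_pos
  have hπ := Real.pi_pos
  have he := Real.exp_pos 1
  refine ⟨1 / (8 * C), 4 * Real.pi * (2 * Real.exp 1 * (1 + rowConst)), by positivity,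
    by positivity, ?_⟩
  intro G _ k h w hG hk hw0 hwh hw hK
  have h0 : 0 < h := hw0.trans_le hwh
  have hh : (0 : ℝ) < h := by exact_mod_cast h0
  have hk' : (2 : ℝ) < k := by exact_mod_cast hk
  set y : ℝ := k * h / (4 * Real.pi) with hy
  have hy1 : 2 * Real.exp 1 * (1 + rowConst) ≤ y := by
    rw [hy, le_div_iff₀ (by positivity)]; linarith
  have hy2 : 2 * Real.exp 1 ≤ y := by nlinarith
  have hy3 : 2 * Real.exp 1 * rowConst ≤ y := by nlinarith
  have he1 : 1 ≤ Real.exp 1 := Real.one_le_exp zero_le_one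
  have hy0 : 0 < y := by linarith
  set Q := poincare G k h with hQ
  set V : ℝ := y ^ ((k : ℝ) / 2) * Real.exp (-((k : ℝ) / 2)) with hV
  have hV0 : 0 < V := by positivity
  -- the value at `i y`
  obtain ⟨z₀, hz₀⟩ : ∃ z₀ : ℍ, z₀.im = y := ⟨⟨⟨0, y⟩, hy0⟩, rfl⟩
  have hval : V / 2 ≤ anorm k Q z₀ := by
    have h1 := norm_poincare_ge hG hk (z := z₀) (by rw [hz₀]; linarith)
    rw [hz₀, show 2 * Real.pi * y / h = (k : ℝ) / 2 by rw [hy]; field_simp; ring] at h1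
    have h2 : rowConst * y ^ (1 - k) ≤ Real.exp (-((k : ℝ) / 2)) / 2 := by
      have e1 : y ^ (1 - k) = (y * y ^ (k - 2))⁻¹ := by
        rw [← zpow_one_add₀ hy0.ne', ← zpow_neg]; congr 1; ring
      have e2 : Real.exp ((k : ℝ) / 2) ≤ Real.exp 1 * y ^ (k - 2) := by
        calc Real.exp ((k : ℝ) / 2) ≤ Real.exp 1 * Real.exp ((k - 2 : ℤ) : ℝ) := by
              rw [← Real.exp_add]
              refine Real.exp_le_exp.mpr ?_
              push_cast
              linarith
          _ = Real.exp 1 * Real.exp 1 ^ (k - 2) := by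
              rw [← Real.rpow_intCast, Real.exp_one_rpow]
          _ ≤ _ := by
              gcongr
              exact zpow_le_zpow_left₀ (by lia) he.le (by linarith)
      have hyk : 0 < y ^ (k - 2) := zpow_pos hy0 _
      rw [e1, Real.exp_neg, ← div_eq_mul_inv, div_le_iff₀ (by positivity)]
      calc rowConst = (Real.exp ((k : ℝ) / 2))⁻¹ / 2 * (2 * rowConst * Real.exp ((k : ℝ) / 2)) := by
            field_simp
        _ ≤ (Real.exp ((k : ℝ) / 2))⁻¹ / 2 * (2 * rowConst * (Real.exp 1 * y ^ (k - 2))) := by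
            gcongr
        _ = (Real.exp ((k : ℝ) / 2))⁻¹ / 2 * ((2 * Real.exp 1 * rowConst) * y ^ (k - 2)) := by ring
        _ ≤ _ := by gcongr
    rw [anorm_eq, hz₀, hV, mul_div_assoc]
    gcongr
    linarith
  -- the supremum
  let F : S G k := cuspFormOf Q (poincare_slash hG) (mdifferentiable_poincare hG hk)
    (isZeroAtImInfty_poincare_slash hG hk h0)
  obtain ⟨B, hB⟩ := CuspFormClass.petersson_bounded_left k (G.map (mapGL ℝ)) F F
  have hbdd : BddAbove (Set.range (anorm k Q)) := by
    refine ⟨√B, ?_⟩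
    rintro _ ⟨z, rfl⟩
    refine Real.sqrt_le_sqrt ?_
    have h1 := hB z
    rw [petersson_self, Complex.norm_real] at h1
    exact (le_abs_self _).trans h1
  set M := ⨆ z, anorm k Q z with hM
  have hMge : ∀ z, anorm k Q z ≤ M := le_ciSup hbdd
  have hMV : V / 2 ≤ M := hval.trans (hMge z₀)
  have hM0 : 0 < M := by linarith
  obtain ⟨z, hz⟩ := exists_lt_of_lt_ciSup (show M / 2 < ⨆ z, anorm k Q z by rw [← hM]; linarith)
  have hpn : M ^ 2 / 4 ≤ pnorm k Q z := by
    rw [← anorm_sq]; nlinarith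
  refine ⟨z, lt_of_lt_of_le (by positivity) hpn, ?_⟩
  refine (mul_le_mul_right (energy_poincare_le hG hk h0 hw0 hw hMge) _).trans ?_
  rw [← ENNReal.ofReal_mul (by positivity)]
  refine ENNReal.ofReal_le_ofReal (le_trans ?_ hpn)
  have hE : 0 ≤ energyBound k h := by
    have := Real.Gamma_pos_of_pos (show 0 < (k : ℝ) / 2 - 1 by linarith)
    unfold energyBound
    positivity
  have hwh' : (w : ℝ) ≤ h := by exact_mod_cast hwh
  calc 1 / (8 * C) * (k : ℝ) ^ (3 / 2 : ℝ) * (M * (w * energyBound k h))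
      ≤ 1 / (8 * C) * (k : ℝ) ^ (3 / 2 : ℝ) * (M * (h * energyBound k h)) := by gcongr
    _ = 1 / (8 * C) * M * ((k : ℝ) ^ (3 / 2 : ℝ) * (h * energyBound k h)) := by ring
    _ ≤ 1 / (8 * C) * M * (C * V) := by
        exact mul_le_mul_of_nonneg_left (hbound k h hk h0 hy2) (by positivity)
    _ = M * V / 8 := by field_simp
    _ ≤ M ^ 2 / 4 := by nlinarith

lemma expH_T_zpow_smul (h : ℕ) (m : ℤ) (z : ℍ) :
    expH h (ModularGroup.T ^ m • z) =
      Complex.exp (2 * Real.pi * Complex.I * m / h) * expH h z := by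
  rw [expH, expH, ModularGroup.coe_T_zpow_smul_eq, ← Complex.exp_add]
  congr 1
  ring

lemma expH_slash_T_zpow (h : ℕ) (k m : ℤ) :
    expH h ∣[k] (ModularGroup.T ^ m) = Complex.exp (2 * Real.pi * Complex.I * m / h) • expH h := by
  ext z
  rw [ModularForm.SL_slash_apply, expH_T_zpow_smul, denom_eq_rowForm, Pi.smul_apply, smul_eq_mul]
  have : rowForm ((ModularGroup.T ^ m).1 1) z = 1 := by
    have := congrArg (fun A ↦ A 1) (ModularGroup.coe_T_zpow m)
    rw [show (ModularGroup.T ^ m).1 1 = ![0, 1] from this]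
    simp [rowForm]
  rw [this, one_zpow, mul_one]

lemma slash_neg (f : ℍ → ℂ) (k : ℤ) (g : SL(2, ℤ)) : f ∣[k] (-g) = (-1 : ℂ) ^ k • (f ∣[k] g) := by
  ext z
  rw [Pi.smul_apply, ModularForm.SL_slash_apply, ModularForm.SL_slash_apply, smul_eq_mul,
    ModularGroup.SL_neg_smul, denom_eq_rowForm, denom_eq_rowForm]
  have : rowForm ((-g).1 1) z = (-1) * rowForm (g.1 1) z := by
    simp [rowForm]
    ring
  rw [this, mul_zpow, zpow_neg (-1 : ℂ) k, ← inv_zpow, inv_neg, inv_one]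
  ring

lemma eq_T_zpow_or_neg {g : SL(2, ℤ)} (hg : g.1 1 0 = 0) :
    ∃ m : ℤ, g = ModularGroup.T ^ m ∨ g = -ModularGroup.T ^ m := by
  have hdet := g.2
  rw [Matrix.det_fin_two, hg, mul_zero, sub_zero] at hdet
  rcases Int.eq_one_or_neg_one_of_mul_eq_one' hdet with ⟨-, h1⟩ | ⟨-, h1⟩
  · have hrow : g.1 1 = (1 : SL(2, ℤ)).1 1 := by
      ext i; fin_cases i
      exacts [hg, h1]
    exact ⟨_, Or.inl (by simpa using exists_eq_T_zpow_mul hrow)⟩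
  · have hrow : (-g).1 1 = (1 : SL(2, ℤ)).1 1 := by
      ext i; fin_cases i
      · simpa using hg
      · simpa using congrArg Neg.neg h1
    have h2 := exists_eq_T_zpow_mul hrow
    rw [mul_one, neg_eq_iff_eq_neg] at h2
    exact ⟨_, Or.inr h2⟩

lemma exp_two_pi_mul_div {h : ℕ} (h0 : 0 < h) {m j : ℤ} (hm : m = h * j) :
    Complex.exp (2 * Real.pi * Complex.I * m / h) = 1 := by
  have hh : (h : ℂ) ≠ 0 := by exact_mod_cast h0.ne'
  rw [Complex.exp_eq_one_iff]
  refine ⟨j, ?_⟩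
  rw [hm]
  push_cast
  field_simp

/-- A suitable period for the exponential: the width `w`, or `2 w` at an irregular cusp. -/
lemma exists_fixesExp {G : Subgroup SL(2, ℤ)} {k : ℤ} {w : ℕ} (hw0 : 0 < w)
    (hw : ∀ m : ℤ, ModularGroup.T ^ m ∈ pm G → (w : ℤ) ∣ m)
    (hwm : ModularGroup.T ^ (w : ℤ) ∈ pm G) (hk : Even k ∨ -1 ∉ G) :
    ∃ h : ℕ, w ≤ h ∧ FixesExp G k h := by
  have hneg : -1 ∉ G → ∀ g, g ∈ G → -g ∉ G := fun h1 g hg hg' ↦ h1 (by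
    have := mul_mem (inv_mem hg) hg'
    simpa using this)
  by_cases hreg : Even k ∨ ModularGroup.T ^ (w : ℤ) ∈ G
  · refine ⟨w, le_rfl, fun g hg hc ↦ ?_⟩
    obtain ⟨m, rfl | rfl⟩ := eq_T_zpow_or_neg hc
    · obtain ⟨j, hj⟩ := hw m (mem_pm.mpr (Or.inl hg))
      rw [expH_slash_T_zpow, exp_two_pi_mul_div hw0 hj, one_smul]
    · obtain ⟨j, hj⟩ := hw m (mem_pm.mpr (Or.inr hg))
      rw [slash_neg, expH_slash_T_zpow, exp_two_pi_mul_div hw0 hj, one_smul]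
      by_cases hk2 : Even k
      · rw [hk2.neg_one_zpow, one_smul]
      · refine absurd hg (hneg (hk.resolve_left hk2) _ ?_)
        rw [hj, zpow_mul]
        exact zpow_mem (hreg.resolve_left hk2) j
  · rw [not_or] at hreg
    obtain ⟨hk2, hT⟩ := hreg
    have h1 := hk.resolve_left hk2
    have hTn : -ModularGroup.T ^ (w : ℤ) ∈ G := (mem_pm.mp hwm).resolve_left hT
    have hodd : (-1 : ℂ) ^ k = -1 := (Int.not_even_iff_odd.mp hk2).neg_one_zpow
    have hTT : ModularGroup.T ^ (w : ℤ) * ModularGroup.T ^ (w : ℤ) ∈ G := by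
      simpa using mul_mem hTn hTn
    have heven : ∀ i : ℤ, ModularGroup.T ^ ((w : ℤ) * (i + i)) ∈ G := fun i ↦ by
      rw [mul_add, ← two_mul, mul_left_comm, ← mul_assoc, zpow_mul, mul_two, zpow_add]
      exact zpow_mem hTT i
    refine ⟨2 * w, by lia, fun g hg hc ↦ ?_⟩
    obtain ⟨m, rfl | rfl⟩ := eq_T_zpow_or_neg hc
    · obtain ⟨j, hj⟩ := hw m (mem_pm.mpr (Or.inl hg))
      rcases Int.even_or_odd j with ⟨i, rfl⟩ | ⟨i, rfl⟩
      · rw [expH_slash_T_zpow, exp_two_pi_mul_div (by lia) (j := i) (by rw [hj]; push_cast; ring),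
          one_smul]
      · refine absurd hg ?_
        have h2 := mul_mem (heven i) hTn
        rw [mul_neg, ← zpow_add] at h2
        rw [hj]
        refine fun h3 ↦ hneg h1 _ h3 ?_
        rwa [show (w : ℤ) * (2 * i + 1) = w * (i + i) + w by ring]
    · obtain ⟨j, hj⟩ := hw m (mem_pm.mpr (Or.inr hg))
      rcases Int.even_or_odd j with ⟨i, rfl⟩ | ⟨i, rfl⟩
      · refine absurd hg (hneg h1 _ ?_)
        rw [hj]
        exact heven i
      · have hexp : Complex.exp (2 * Real.pi * Complex.I * m / (2 * w : ℕ)) = -1 := by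
          have hw' : (w : ℂ) ≠ 0 := by exact_mod_cast hw0.ne'
          rw [hj, ← Complex.exp_pi_mul_I, Complex.exp_eq_exp_iff_exists_int]
          refine ⟨i, ?_⟩
          push_cast
          field_simp
          ring
        rw [slash_neg, expH_slash_T_zpow, hexp, hodd]
        simp

/-! ### Congruence subgroups with bounded widths -/

/-- The product of the primes dividing `M` but not `d` serves as `x`. -/
lemma exists_isCoprime_add_mul {d q : ℤ} (hdq : IsCoprime d q) {M : ℕ} (hM : M ≠ 0) :
    ∃ x : ℤ, IsCoprime (d + q * x) M := by
  classical
  set P := M.primeFactors.filter fun p : ℕ ↦ ¬ (p : ℤ) ∣ d with hP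
  refine ⟨((∏ p ∈ P, p : ℕ) : ℤ), ?_⟩
  rw [Int.isCoprime_iff_gcd_eq_one]
  refine Nat.coprime_of_dvd fun p hp h1 h2 ↦ ?_
  rw [← Int.natCast_dvd] at h1
  rw [Int.natAbs_natCast] at h2
  have hpM : p ∈ M.primeFactors := Nat.mem_primeFactors.mpr ⟨hp, h2, hM⟩
  have hpi : Prime (p : ℤ) := Nat.prime_iff_prime_int.mp hp
  by_cases hd : (p : ℤ) ∣ d
  · rcases hpi.dvd_or_dvd ((dvd_add_right hd).mp h1) with h3 | h3
    · exact hpi.not_isUnit (hdq.isUnit_of_dvd' hd h3)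
    · rw [Int.natCast_dvd_natCast, hp.prime.dvd_finsetProd_iff] at h3
      obtain ⟨p', hp', h4⟩ := h3
      rw [hP, Finset.mem_filter] at hp'
      have h5 := (Nat.prime_dvd_prime_iff_eq hp (Nat.prime_of_mem_primeFactors hp'.1)).mp h4
      exact hp'.2 (h5 ▸ hd)
  · have hmem : p ∈ P := Finset.mem_filter.mpr ⟨hpM, hd⟩
    have h3 : (p : ℤ) ∣ ((∏ p ∈ P, p : ℕ) : ℤ) :=
      Int.natCast_dvd_natCast.mpr (Finset.dvd_prod_of_mem _ hmem)
    exact hd ((dvd_add_left (h3.mul_left q)).mp h1)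

lemma mem_Gamma_iff_dvd {N : ℕ} {g : SL(2, ℤ)} : g ∈ CongruenceSubgroup.Gamma N ↔
    (N : ℤ) ∣ g.1 0 0 - 1 ∧ (N : ℤ) ∣ g.1 0 1 ∧ (N : ℤ) ∣ g.1 1 0 ∧ (N : ℤ) ∣ g.1 1 1 - 1 := by
  rw [CongruenceSubgroup.Gamma_mem]
  simp only [← ZMod.intCast_zmod_eq_zero_iff_dvd, Int.cast_sub, Int.cast_one, sub_eq_zero]

/-- The product of two conjugates of powers of `T` which is used to clear the bottom row. -/
lemma conj_T_mul_conj_T (u r : ℤ) :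
    ∃ L : SL(2, ℤ), ((L * ModularGroup.T ^ u * L⁻¹) *
      (ModularGroup.S * ModularGroup.T ^ (-r) * ModularGroup.S⁻¹) : SL(2, ℤ)).1 =
      !![1 - u + u * r, u; -u + (1 + u) * r, 1 + u] := by
  obtain ⟨L, hL⟩ : ∃ L : SL(2, ℤ), L.1 = !![1, 0; 1, 1] := ⟨⟨!![1, 0; 1, 1], by simp⟩, rfl⟩
  refine ⟨L, ?_⟩
  rw [Matrix.SpecialLinearGroup.coe_mul, Matrix.SpecialLinearGroup.coe_mul,
    Matrix.SpecialLinearGroup.coe_mul, Matrix.SpecialLinearGroup.coe_mul,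
    Matrix.SpecialLinearGroup.coe_mul, Matrix.SpecialLinearGroup.coe_inv,
    Matrix.SpecialLinearGroup.coe_inv, ModularGroup.coe_T_zpow, ModularGroup.coe_T_zpow,
    ModularGroup.coe_S, hL, Matrix.adjugate_fin_two, Matrix.adjugate_fin_two]
  ext i j
  fin_cases i <;> fin_cases j <;>
    simp [Matrix.mul_apply, Fin.sum_univ_two, -mul_eq_mul_right_iff] <;> ring

/-- Wohlfahrt's theorem: a congruence subgroup which contains all the conjugates of `T ^ N`
contains `Γ(N)`. -/
lemma Gamma_le_of_conj_T_mem {Γ : Subgroup SL(2, ℤ)}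
    (hΓ : CongruenceSubgroup.IsCongruenceSubgroup Γ) {N : ℕ}
    (hT : ∀ σ : SL(2, ℤ), σ * ModularGroup.T ^ (N : ℤ) * σ⁻¹ ∈ Γ) :
    CongruenceSubgroup.Gamma N ≤ Γ := by
  obtain ⟨M, hM0, hM⟩ := hΓ
  have hTj : ∀ (σ : SL(2, ℤ)) (n : ℤ), (N : ℤ) ∣ n → σ * ModularGroup.T ^ n * σ⁻¹ ∈ Γ := by
    rintro σ _ ⟨j, rfl⟩
    have := zpow_mem (hT σ) j
    rwa [conj_zpow, ← zpow_mul] at this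
  have hT1 : ∀ n : ℤ, (N : ℤ) ∣ n → ModularGroup.T ^ n ∈ Γ := fun n hn ↦ by
    simpa using hTj 1 n hn
  -- the case where the lower right entry is a unit modulo `M`
  have hunit : ∀ γ ∈ CongruenceSubgroup.Gamma N, IsCoprime (γ.1 1 1) M → γ ∈ Γ := by
    intro γ hγ hcop
    obtain ⟨-, hb, hc, hd⟩ := mem_Gamma_iff_dvd.mp hγ
    have hdet := γ.2
    rw [Matrix.det_fin_two] at hdet
    set a := γ.1 0 0
    set b := γ.1 0 1
    set c := γ.1 1 0
    set d := γ.1 1 1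
    obtain ⟨e, f, hef⟩ := hcop
    set u := d - 1 with hu
    set r := e * (c + u) with hr
    have hdr : d * r = c + u - M * (f * (c + u)) := by
      rw [hr]; linear_combination (c + u) * hef
    obtain ⟨L, hL⟩ := conj_T_mul_conj_T u r
    set B := (L * ModularGroup.T ^ u * L⁻¹) *
      (ModularGroup.S * ModularGroup.T ^ (-r) * ModularGroup.S⁻¹)
    have hNr : (N : ℤ) ∣ r := (dvd_add hc hd).mul_left e
    have hB : B ∈ Γ := mul_mem (hTj _ _ hd) (hTj _ _ (dvd_neg.mpr hNr))
    set δ := γ * B⁻¹ with hδ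
    have hδv : δ.1 = γ.1 * !![1 + u, -u; -(-u + (1 + u) * r), 1 - u + u * r] := by
      rw [hδ, Matrix.SpecialLinearGroup.coe_mul, Matrix.SpecialLinearGroup.coe_inv, hL,
        Matrix.adjugate_fin_two]
      simp
    have h01 : δ.1 0 1 = -(a * u) + b * (1 - u + u * r) := by
      rw [hδv, Matrix.mul_apply, Fin.sum_univ_two]; simp; ring
    have h10 : δ.1 1 0 = c * (1 + u) - d * (-u + (1 + u) * r) := by
      rw [hδv, Matrix.mul_apply, Fin.sum_univ_two]; simp; ring
    have h11 : δ.1 1 1 = -(c * u) + d * (1 - u + u * r) := by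
      rw [hδv, Matrix.mul_apply, Fin.sum_univ_two]; simp; ring
    have hu1 : 1 + u = d := by rw [hu]; ring
    have hM10 : (M : ℤ) ∣ δ.1 1 0 :=
      ⟨d * (f * (c + u)), by rw [h10, hu1]; linear_combination (-d) * hdr⟩
    have hM11 : (M : ℤ) ∣ δ.1 1 1 - 1 :=
      ⟨-(u * (f * (c + u))), by rw [h11]; linear_combination u * hdr + (d - u) * hu1 - hu1⟩
    have hN01 : (N : ℤ) ∣ δ.1 0 1 := by
      rw [h01]
      exact dvd_add (dvd_neg.mpr (hd.mul_left a)) (hb.mul_right _)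
    have hδdet := δ.2
    rw [Matrix.det_fin_two] at hδdet
    set s := δ.1 0 1
    have hfin : ModularGroup.T ^ (-s) * δ ∈ Γ := by
      refine hM (mem_Gamma_iff_dvd.mpr ?_)
      rw [Matrix.SpecialLinearGroup.coe_mul, ModularGroup.coe_T_zpow]
      simp only [Matrix.mul_apply, Fin.sum_univ_two]
      obtain ⟨i, hi⟩ := hM10
      obtain ⟨j, hj⟩ := hM11
      have hj' : δ.1 1 1 = 1 + M * j := by linarith
      refine ⟨⟨-(δ.1 0 0 * j), ?_⟩, ⟨-(s * j), ?_⟩, ⟨i, ?_⟩, ⟨j, ?_⟩⟩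
      · simp
        rw [hi]
        rw [hi, hj'] at hδdet
        linear_combination hδdet
      · simp
        rw [hj']
        ring
      · simpa using hi
      · simpa using hj
    have := mul_mem (mul_mem (hT1 s hN01) hfin) hB
    convert this using 1
    rw [hδ]
    simp [← mul_assoc]
  intro γ hγ
  obtain ⟨-, -, -, hd⟩ := mem_Gamma_iff_dvd.mp hγ
  have hdet := γ.2
  rw [Matrix.det_fin_two] at hdet
  have hcop : IsCoprime (γ.1 1 1) (γ.1 1 0 * N) := by
    refine IsCoprime.mul_right ⟨γ.1 0 0, -γ.1 0 1, by linear_combination hdet⟩ ?_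
    obtain ⟨j, hj⟩ := hd
    exact ⟨1, -j, by linear_combination hj⟩
  obtain ⟨x, hx⟩ := exists_isCoprime_add_mul hcop hM0
  have hTx : ModularGroup.T ^ ((N : ℤ) * x) ∈ CongruenceSubgroup.Gamma N := by
    rw [mem_Gamma_iff_dvd, ModularGroup.coe_T_zpow]
    simp
  have h1 := hunit (γ * ModularGroup.T ^ ((N : ℤ) * x)) (mul_mem hγ hTx) (by
    rw [Matrix.SpecialLinearGroup.coe_mul, ModularGroup.coe_T_zpow, Matrix.mul_apply,
      Fin.sum_univ_two]
    convert hx using 1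
    simp
    ring)
  have := mul_mem h1 (inv_mem (hT1 _ (dvd_mul_right (N : ℤ) x)))
  rwa [mul_inv_cancel_right] at this

/-- If all the widths of the cusps of a congruence subgroup are at most `W`, then the volume of its
fundamental domain is bounded in terms of `W`. -/
lemma exists_volume_le (W : ℕ) : ∃ V : ℝ, 0 < V ∧ ∀ Γ : Subgroup SL(2, ℤ),
    CongruenceSubgroup.IsCongruenceSubgroup Γ →
    (∀ σ : SL(2, ℤ), ∃ w : ℕ, 0 < w ∧ w ≤ W ∧ ModularGroup.T ^ (w : ℤ) ∈ pm (conj σ Γ)) →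
    volume (fundDomain Γ) ≤ ENNReal.ofReal V := by
  set N : ℕ := 2 * W.factorial with hN
  have : NeZero N := ⟨by positivity⟩
  have hidx : 0 < (CongruenceSubgroup.Gamma N).index :=
    Nat.pos_of_ne_zero Subgroup.FiniteIndex.index_ne_zero
  refine ⟨2 * (CongruenceSubgroup.Gamma N).index, by positivity, fun Γ hΓ hw ↦ ?_⟩
  have := hΓ.finiteIndex
  have hle : CongruenceSubgroup.Gamma N ≤ Γ := by
    refine Gamma_le_of_conj_T_mem hΓ fun σ ↦ ?_
    obtain ⟨w, hw0, hwW, hwT⟩ := hw σ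
    obtain ⟨j, hj⟩ := Nat.dvd_factorial hw0 hwW
    have h1 := zpow_mem (T_zpow_two_mul_mem hwT) (j : ℤ)
    rw [← zpow_mul, show 2 * (w : ℤ) * j = (N : ℤ) by rw [hN, hj]; push_cast; ring] at h1
    exact mem_conj.mp h1
  refine (volume_fundDomain_le Γ).trans (ENNReal.ofReal_le_ofReal ?_)
  have : Γ.index ≤ (CongruenceSubgroup.Gamma N).index := Subgroup.index_antitone hle
  have : (Γ.index : ℝ) ≤ (CongruenceSubgroup.Gamma N).index := by exact_mod_cast this
  linarith

/-! ### The lower bound -/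

lemma even_or_neg_one_notMem {Γ : Subgroup SL(2, ℤ)} {k : ℤ} [Nontrivial (S Γ k)] :
    Even k ∨ -1 ∉ Γ := by
  by_contra! hcon
  obtain ⟨hk, hΓ⟩ := hcon
  obtain ⟨F, hF⟩ := exists_ne (0 : S Γ k)
  refine hF ?_
  ext z
  have h := congrFun (slash_eq F hΓ) z
  rw [slash_neg, (Int.not_even_iff_odd.mp hk).neg_one_zpow, SlashAction.slash_one,
    Pi.smul_apply, smul_eq_mul, neg_one_mul, neg_eq_self] at h
  exact h

/-- If the weight and the volume are bounded, any nonzero form gives a lower bound, at a point where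
it is at least half its supremum. -/
lemma exists_lower_of_volume_le {Γ : Subgroup SL(2, ℤ)} [Γ.FiniteIndex] {k : ℤ} {V : ℝ}
    (hV : 0 < V) (hvol : volume (fundDomain Γ) ≤ ENNReal.ofReal V) {F : S Γ k} (hF : F ≠ 0) :
    ∃ z, 0 < pnorm k F z ∧
      ENNReal.ofReal (1 / (2 * V)) * energy Γ k F ≤ ENNReal.ofReal (pnorm k F z) := by
  obtain ⟨B, hB⟩ := CuspFormClass.petersson_bounded_left k (Γ.map (mapGL ℝ)) F F
  have hbdd : BddAbove (Set.range (pnorm k F)) := by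
    refine ⟨B, ?_⟩
    rintro _ ⟨z, rfl⟩
    have h1 := hB z
    rw [petersson_self, Complex.norm_real] at h1
    exact (le_abs_self _).trans h1
  set M := ⨆ z, pnorm k F z with hM
  have hMge : ∀ z, pnorm k F z ≤ M := le_ciSup hbdd
  have hM0 : 0 < M := by
    obtain ⟨z, hz⟩ : ∃ z, F z ≠ 0 := by
      by_contra! h
      exact hF (DFunLike.ext _ _ h)
    have := norm_pos_iff.mpr hz
    have := zpow_pos z.im_pos k
    exact (show 0 < pnorm k F z by unfold pnorm; positivity).trans_le (hMge z)
  obtain ⟨z, hz⟩ := exists_lt_of_lt_ciSup (show M / 2 < ⨆ z, pnorm k F z by rw [← hM]; linarith)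
  refine ⟨z, by linarith, ?_⟩
  have hE : energy Γ k F ≤ ENNReal.ofReal (M * V) := by
    calc energy Γ k F ≤ ∫⁻ z in fundDomain Γ, ENNReal.ofReal M :=
          lintegral_mono fun z ↦ ENNReal.ofReal_le_ofReal (hMge z)
      _ ≤ _ := by
          rw [setLIntegral_const, ENNReal.ofReal_mul hM0.le]
          exact mul_le_mul_right hvol _
  refine (mul_le_mul_right hE _).trans ?_
  rw [← ENNReal.ofReal_mul (by positivity)]
  refine ENNReal.ofReal_le_ofReal ?_
  calc 1 / (2 * V) * (M * V) = M / 2 := by field_simp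
    _ ≤ _ := hz.le

/-- The Poincaré series at a cusp `σ ∞` with `k w` large, and otherwise any form: in the latter case
the weight and, by Wohlfahrt's theorem, the volume are bounded. -/
lemma exists_lower : ∃ c : ℝ, 0 < c ∧ ∀ Γ : Subgroup SL(2, ℤ),
    CongruenceSubgroup.IsCongruenceSubgroup Γ → ∀ k : ℤ, 2 < k → Nontrivial (S Γ k) →
    ∃ (F : S Γ k) (z : ℍ), 0 < pnorm k F z ∧
      ENNReal.ofReal (c * (k : ℝ) ^ (3 / 2 : ℝ)) * energy Γ k F ≤ ENNReal.ofReal (pnorm k F z) := by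
  obtain ⟨c, K, hc, hK, hlow⟩ := exists_poincare_lower
  obtain ⟨V, hV, hvol⟩ := exists_volume_le ⌊K⌋₊
  refine ⟨min c (1 / (2 * V * K ^ (3 / 2 : ℝ))), lt_min hc (by positivity),
    fun Γ hΓ k hk hnt ↦ ?_⟩
  have := hΓ.finiteIndex
  have hk0 : (0 : ℝ) < k := by exact_mod_cast (by lia : (0 : ℤ) < k)
  have hk1 : (1 : ℝ) ≤ k := by exact_mod_cast (by lia : (1 : ℤ) ≤ k)
  choose w hw0 hw using fun σ : SL(2, ℤ) ↦ exists_width (conj σ Γ)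
  have hwT : ∀ σ, ModularGroup.T ^ (w σ : ℤ) ∈ pm (conj σ Γ) := fun σ ↦ (hw σ _).mpr dvd_rfl
  by_cases hbig : ∃ σ, K ≤ k * w σ
  · obtain ⟨σ, hσ⟩ := hbig
    have hpar : Even k ∨ -1 ∉ conj σ Γ :=
      (even_or_neg_one_notMem (Γ := Γ) (k := k)).imp_right fun h h' ↦ h (by
        simpa using mem_conj.mp h')
    obtain ⟨h, hwh, hG⟩ := exists_fixesExp (hw0 σ) (fun m ↦ (hw σ m).mp) (hwT σ) hpar
    have hwh' : (w σ : ℝ) ≤ h := by exact_mod_cast hwh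
    obtain ⟨z, hz0, hz⟩ := hlow (conj σ Γ) k h (w σ) hG hk (hw0 σ) hwh (fun m ↦ (hw σ m).mpr)
      (hσ.trans (by gcongr))
    set Q := poincare (conj σ Γ) k h
    have hinv : ∀ γ ∈ Γ, (Q ∣[k] σ⁻¹) ∣[k] γ = Q ∣[k] σ⁻¹ := fun γ hγ ↦
      slash_conj (poincare_slash hG) σ⁻¹ γ (mem_conj.mpr (mem_conj.mpr (by
        simpa [mul_assoc] using hγ)))
    let F : S Γ k := cuspFormOf (Q ∣[k] σ⁻¹) hinv
      (mdifferentiable_slash (mdifferentiable_poincare hG hk) k _) fun g ↦ by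
        rw [← SlashAction.slash_mul]
        exact isZeroAtImInfty_poincare_slash hG hk ((hw0 σ).trans_le hwh) _
    have hFσ : (F : ℍ → ℂ) ∣[k] σ = Q := by
      change (Q ∣[k] σ⁻¹) ∣[k] σ = Q
      rw [← SlashAction.slash_mul, inv_mul_cancel, SlashAction.slash_one]
    have hE : energy (conj σ Γ) k Q = energy Γ k F := by
      rw [← hFσ]
      exact energy_conj hinv σ
    rw [← hFσ, pnorm_slash] at hz0
    rw [hE, ← hFσ, pnorm_slash] at hz
    refine ⟨F, σ • z, hz0, le_trans (mul_le_mul_left (ENNReal.ofReal_le_ofReal ?_) _) hz⟩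
    gcongr
    exact min_le_left _ _
  · push Not at hbig
    have hkK : (k : ℝ) ≤ K := by
      have h1 : (1 : ℝ) ≤ w 1 := by exact_mod_cast hw0 1
      nlinarith [hbig 1]
    have hv := hvol Γ hΓ fun σ ↦ ⟨w σ, hw0 σ, Nat.le_floor (by
      have : (0 : ℝ) ≤ w σ := Nat.cast_nonneg _
      nlinarith [hbig σ]), hwT σ⟩
    obtain ⟨F, hF⟩ := exists_ne (0 : S Γ k)
    obtain ⟨z, hz0, hz⟩ := exists_lower_of_volume_le hV hv hF
    refine ⟨F, z, hz0, le_trans (mul_le_mul_left (ENNReal.ofReal_le_ofReal ?_) _) hz⟩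
    calc _ ≤ 1 / (2 * V * K ^ (3 / 2 : ℝ)) * K ^ (3 / 2 : ℝ) := by
          gcongr
          exact min_le_right _ _
      _ = 1 / (2 * V) := by field_simp

end CuspSize

end

theorem mainTheorem10 :
    ∃ c C : ℝ, 0 < c ∧ 0 < C ∧
      ∀ Γ : Subgroup SL(2, ℤ), CongruenceSubgroup.IsCongruenceSubgroup Γ →
      ∀ k : ℤ, 2 < k →
        (∃ (n : ℕ) (B : Module.Basis (Fin n) ℂ (CuspSize.S Γ k)),
          CuspSize.IsPeterssonOrthonormal B) ∧
        ∀ (n : ℕ) (B : Module.Basis (Fin n) ℂ (CuspSize.S Γ k)),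
          CuspSize.IsPeterssonOrthonormal B →
            CuspSize.size B ≤ ENNReal.ofReal (C * (k : ℝ) ^ (3 / 2 : ℝ)) ∧
            (Nontrivial (CuspSize.S Γ k) →
              ENNReal.ofReal (c * (k : ℝ) ^ (3 / 2 : ℝ)) ≤ CuspSize.size B) := by
  obtain ⟨C, hC, hup⟩ := CuspSize.exists_sum_pnorm_le
  obtain ⟨c, hc, hlow⟩ := CuspSize.exists_lower
  refine ⟨c, C, hc, hC, fun Γ hΓ k hk ↦ ?_⟩
  have := hΓ.finiteIndex
  refine ⟨CuspSize.exists_isPeterssonOrthonormal Γ hk, fun n B hB ↦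
    ⟨iSup_le fun z ↦ ENNReal.ofReal_le_ofReal (hup Γ k hk n B hB z), fun hnt ↦ ?_⟩⟩
  obtain ⟨F, z, hz0, hz⟩ := hlow Γ hΓ k hk hnt
  have h1 := CuspSize.pnorm_le_energy_mul_bergman hk hB F z
  have hE0 : CuspSize.energy Γ k F ≠ 0 := by
    intro h
    rw [h, zero_mul, nonpos_iff_eq_zero, ENNReal.ofReal_eq_zero] at h1
    linarith
  have hE : CuspSize.energy Γ k F ≠ ⊤ := (CuspSize.peterssonInner_self F).2
  rw [mul_comm] at hz
  exact ((ENNReal.mul_le_mul_iff_right hE0 hE).mp (hz.trans h1)).trans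
    (le_iSup (fun z ↦ ENNReal.ofReal (CuspSize.bergman B z)) z)
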